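/- Let $(\xi,\eta)$ be a random vector in $\mathbb R^2$ with $\xi>0$ and $\eta=\xi$ almost surely. Assume that the distribution of $\xi$ is nonlattice (it is not concentrated on $\{nd:n\in\mathbb N_0\}$ for any $d>0$) and that $s^2:=\operatorname{Var}\xi\in(0,\infty)$, and put $m:=\mathbb E\xi<\infty$. Consider the following general branching process. At time $0$ there is one individual, the ancestor (generation $0$). Each individual $v$ has countably many children, born at the times $b(v)+T^{(v)}_1,\ b(v)+T^{(v)}_2,\dots$, where $b(v)$ is the birth time of $v$ and $T^{(v)}_i:=\xi^{(v)}_1+\dots+\xi^{(v)}_{i-1}+\eta^{(v)}_i$; here the pairs $(\xi^{(v)}_i,\eta^{(v)}_i)$, over all individuals $v$ and all $i\in\mathbb N$, are independent copies of $(\xi,\eta)$. (Since $\eta=\xi$ a.s., $T^{(v)}_i=\xi^{(v)}_1+\dots+\xi^{(v)}_i$ a.s., so each $T^{(v)}$ is a standard random walk.) For $j\in\mathbb N=\{1,2,\dots\}$ and $t\ge 0$, let $N_j(t)$ be the number of individuals of generation $j$ with birth time at most $t$. Then, for every fixed $j\in\mathbb N$, almost surely $N_j(t)<\infty$ for all $t\ge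 0$, $\mathbb E N_j(t)^2<\infty$ for every $t\ge 0$, and $$\lim_{t\to\infty}\frac{\operatorname{Var}N_j(t)}{t^{2j-1}}=\frac{s^2}{(2j-1)\,((j-1)!)^2\,m^{2j+1}}.$$ -/

import Mathlib

open MeasureTheory ProbabilityTheory Filter Topology

/-- The perturbed random walk `T₁, T₂, …` built from a sequence of pairs `(ξ₁, η₁), (ξ₂, η₂), …`.
Indices start at zero here: `perturbedWalk x i` is `T_{i+1} = ξ₁ + ⋯ + ξ_i + η_{i+1}`, where
`x k = (ξ_{k+1}, η_{k+1})`. -/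
def perturbedWalk (x : ℕ → ℝ × ℝ) (i : ℕ) : ℝ :=
  (∑ k ∈ Finset.range i, (x k).1) + (x i).2

/-- Birth times in the general branching process. Individuals are labelled by finite lists of
natural numbers: `[]` is the ancestor, born at time `0`, and `i :: v` is the child number `i` of
`v`. The sequence `x v` drives the reproduction of `v`: its children are born at the ages
`perturbedWalk (x v) 0, perturbedWalk (x v) 1, …` of `v`. -/
def birthTime (x : List ℕ → ℕ → ℝ × ℝ) : List ℕ → ℝ
  | [] => 0
  | i :: v => birthTime x v + perturbedWalk (x v) i

/-- `N_j(t)`: the number (possibly infinite) of individuals of generation `j` with birth times at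
most `t`. -/
noncomputable def generationCount (x : List ℕ → ℕ → ℝ × ℝ) (j : ℕ) (t : ℝ) : ℕ∞ :=
  {v : List ℕ | v.length = j ∧ birthTime x v ≤ t}.encard

/-- A law `μ` of a positive random variable is nonlattice if it is not concentrated on
`{0, d, 2d, …}` for any `d > 0`. -/
def IsNonlattice (μ : Measure ℝ) : Prop :=
  ∀ d : ℝ, 0 < d → ¬ ∀ᵐ y ∂μ, ∃ n : ℕ, y = n * d

/-! Write `m`, `s²` for the mean and variance of a step and `S_k` for the walk. For monotone `g ≥ 0`
vanishing on the negative half-line, put `T = ∑_{k≥1} g(t - S_k)`. Replacing `m` by `ξ_{k+1} -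
(ξ_{k+1} - m)` in `m ∑ g(t - S_k)` gives, up to boundary terms, `m T = ∫₀ᵗ g + R - D`. Here `R ≥ 0`
is the error of the Riemann sum with mesh `ξ_{k+1}`, and `D = ∑ (ξ_{k+1} - m) g(t - S_k)` is a
martingale.

Suppose `g(t) ~ c t^k`. Truncating the steps at a slowly growing level gives `E R = o(t^{k+1})` and
`E R² = o(t^{2k+1})`, from two moments of the step alone. Hence `E T ~ c t^{k+1} / ((k+1) m)`.
Orthogonality of increments gives `Var D = s² E ∑_{k≥0} g(t - S_k)²`; applying the mean asymptotics
to `g²` yields `Var T ~ s² c² t^{2k+1} / ((2k+1) m³)`.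

For the tree, condition on the ancestor's walk. The mean `v_{j+1}` of generation `j+1` is `E ∑ v_j(t
- S_i)`, so `v_j ~ t^j / (j! m^j)`. By the law of total variance, `Var N_{j+1}(t) = Var ∑ v_j(t -
S_i) + E ∑ (w_j - v_j²)(t - S_i)`, where `w_j` is the second moment. Inductively `w_j ~ v_j²`, so
the second term is `o(t^{2j+1})`, and the first gives the limit with `c = 1 / (j! m^j)`. The
resulting order `t^{2j+1}` of the variance is below `t^{2j+2}`, so `w_{j+1} ~ v_{j+1}²` and the
induction continues. -/

/-- If `g` is monotone and `g t / t ^ k → c`, then `(∫ u in 0..t, g u) / t ^ (k + 1) → c / (k + 1)`. -/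
theorem Monotone.tendsto_integral_div_pow {g : ℝ → ℝ} (hg : Monotone g) (hg0 : ∀ t, 0 ≤ g t)
    {k : ℕ} {c : ℝ} (hc : Tendsto (fun t => g t / t ^ k) atTop (𝓝 c)) :
    Tendsto (fun t => (∫ u in (0 : ℝ)..t, g u) / t ^ (k + 1)) atTop (𝓝 (c / (k + 1))) := by
  -- Substituting `u = t s` fixes the interval. Monotonicity gives `g (t * s) ≤ g t`, which supplies
  -- the dominating constant.
  have key : Tendsto (fun t : ℝ => ∫ s in (0 : ℝ)..1, g (t * s) / t ^ k) atTop
      (𝓝 (∫ s in (0 : ℝ)..1, c * s ^ k)) := by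
    refine intervalIntegral.tendsto_integral_filter_of_dominated_convergence
      (fun _ => |c| + 1) ?_ ?_ ?_ ?_
    · refine Eventually.of_forall fun t => ?_
      exact ((hg.measurable.comp (measurable_const.mul measurable_id)).div_const _).aestronglyMeasurable
    · have h1 : ∀ᶠ t : ℝ in atTop, g t / t ^ k ≤ |c| + 1 :=
        (hc.eventually_lt_const (by linarith [le_abs_self c] : c < |c| + 1)).mono fun _ h => h.le
      filter_upwards [h1, eventually_gt_atTop 0] with t ht ht0
      refine Eventually.of_forall fun s hs => ?_
      rw [Set.uIoc_of_le zero_le_one] at hs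
      rw [Real.norm_of_nonneg (div_nonneg (hg0 _) (by positivity))]
      refine le_trans ?_ ht
      gcongr
      exact hg (by nlinarith [hs.2])
    · exact intervalIntegrable_const
    · refine Eventually.of_forall fun s hs => ?_
      rw [Set.uIoc_of_le zero_le_one] at hs
      have h2 : Tendsto (fun t : ℝ => t * s) atTop atTop := tendsto_id.atTop_mul_const hs.1
      have h3 := (hc.comp h2).mul_const (s ^ k)
      refine h3.congr' ?_
      filter_upwards [eventually_gt_atTop 0] with t ht
      have := hs.1
      simp only [Function.comp, mul_pow]
      field_simp
  have hval : ∫ s in (0 : ℝ)..1, c * s ^ k = c / (k + 1) := by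
    rw [intervalIntegral.integral_const_mul, integral_pow]
    simp; ring
  rw [hval] at key
  refine key.congr' ?_
  filter_upwards [eventually_gt_atTop 0] with t ht
  rw [intervalIntegral.integral_div, intervalIntegral.integral_comp_mul_left _ ht.ne']
  simp only [mul_zero, mul_one, smul_eq_mul, pow_succ]
  field_simp

/-! ### Pathwise Riemann sum estimates -/

/-- The walk `S_n = x_0 + ⋯ + x_{n-1}`. -/
def walk (x : ℕ → ℝ) (n : ℕ) : ℝ := ∑ k ∈ Finset.range n, x k

@[simp] theorem walk_zero (x : ℕ → ℝ) : walk x 0 = 0 := by simp [walk]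

theorem walk_succ (x : ℕ → ℝ) (n : ℕ) : walk x (n + 1) = walk x n + x n := by
  simp [walk, Finset.sum_range_succ]

theorem walk_nonneg {x : ℕ → ℝ} (hx : ∀ k, 0 < x k) (n : ℕ) : 0 ≤ walk x n :=
  Finset.sum_nonneg fun k _ => (hx k).le

section Deterministic

variable {g : ℝ → ℝ} {x : ℕ → ℝ}

theorem intervalIntegrable_comp_sub (hg : Monotone g) (t a b : ℝ) :
    IntervalIntegrable (fun u => g (t - u)) volume a b :=
  Antitone.intervalIntegrable fun _ _ h => hg (by linarith)

theorem mul_le_integral_comp_sub (hg : Monotone g) (t : ℝ) {a h : ℝ} (hh : 0 ≤ h) :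
    h * g (t - (a + h)) ≤ ∫ u in a..(a + h), g (t - u) := by
  have := intervalIntegral.integral_mono_on (a := a) (b := a + h) (by linarith)
    (intervalIntegrable_const (c := g (t - (a + h)))) (intervalIntegrable_comp_sub hg t a (a + h))
    (fun u hu => hg (by linarith [hu.2]))
  simpa using this

theorem integral_comp_sub_le_mul (hg : Monotone g) (t : ℝ) {a h : ℝ} (hh : 0 ≤ h) :
    ∫ u in a..(a + h), g (t - u) ≤ h * g (t - a) := by
  have := intervalIntegral.integral_mono_on (a := a) (b := a + h) (by linarith)
    (intervalIntegrable_comp_sub hg t a (a + h)) (intervalIntegrable_const (c := g (t - a)))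
    (fun u hu => hg (by linarith [hu.1]))
  simpa using this

theorem integral_walk_succ (hg : Monotone g) (t : ℝ) (n : ℕ) :
    ∫ u in (0 : ℝ)..walk x (n + 1), g (t - u) =
      (∫ u in (0 : ℝ)..walk x n, g (t - u)) +
        ∫ u in (walk x n)..(walk x n + x n), g (t - u) := by
  rw [walk_succ, intervalIntegral.integral_add_adjacent_intervals] <;>
  exact intervalIntegrable_comp_sub hg _ _ _

theorem integral_le_sum_walk (hg : Monotone g) (hx : ∀ k, 0 < x k) (t : ℝ) (n : ℕ) :
    ∫ u in (0 : ℝ)..walk x n, g (t - u) ≤ ∑ k ∈ Finset.range n, x k * g (t - walk x k) := by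
  induction n with
  | zero => simp
  | succ n ih =>
    rw [integral_walk_succ hg, Finset.sum_range_succ]
    exact add_le_add ih (integral_comp_sub_le_mul hg t (hx n).le)

/-- Over each step `g (t - u)` stays between its endpoint values, so the error is at most step
length times drop of `g`. -/
theorem sum_walk_sub_integral_le (hg : Monotone g) (hx : ∀ k, 0 < x k) (t : ℝ) (n : ℕ) :
    (∑ k ∈ Finset.range n, x k * g (t - walk x k)) - ∫ u in (0 : ℝ)..walk x n, g (t - u) ≤
      ∑ k ∈ Finset.range n, x k * (g (t - walk x k) - g (t - walk x (k + 1))) := by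
  induction n with
  | zero => simp
  | succ n ih =>
    rw [integral_walk_succ hg, Finset.sum_range_succ, Finset.sum_range_succ]
    have := mul_le_integral_comp_sub hg t (a := walk x n) (hx n).le
    rw [← walk_succ] at this ⊢
    linarith

theorem comp_sub_walk_succ_le (hg : Monotone g) (hx : ∀ k, 0 < x k) (t : ℝ) (k : ℕ) :
    g (t - walk x (k + 1)) ≤ g (t - walk x k) :=
  hg (by rw [walk_succ]; linarith [hx k])

theorem sum_increments_le (hg0 : ∀ t, 0 ≤ g t) (t : ℝ) (n : ℕ) :
    ∑ k ∈ Finset.range n, (g (t - walk x k) - g (t - walk x (k + 1))) ≤ g t := by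
  rw [Finset.sum_range_sub']
  simpa using hg0 _

/-- Steps of length at most `A` are handled by telescoping. For longer steps the drop is bounded by
`g (t - walk x k)`, which does not involve `x k`, so that expectations factor later. -/
theorem sum_pow_mul_increments_le (hg : Monotone g) (hg0 : ∀ t, 0 ≤ g t) (hx : ∀ k, 0 < x k)
    (t : ℝ) (n p : ℕ) {A : ℝ} (hA : 0 ≤ A) :
    ∑ k ∈ Finset.range n, x k ^ p * (g (t - walk x k) - g (t - walk x (k + 1))) ≤
      A ^ p * g t + ∑ k ∈ Finset.range n, (Set.Ioi A).indicator (· ^ p) (x k) * g (t - walk x k) := by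
  calc _ ≤ ∑ k ∈ Finset.range n, (A ^ p * (g (t - walk x k) - g (t - walk x (k + 1))) +
        (Set.Ioi A).indicator (· ^ p) (x k) * g (t - walk x k)) := by
        refine Finset.sum_le_sum fun k _ => ?_
        have h1 := comp_sub_walk_succ_le hg hx t k
        have h2 := hg0 (t - walk x (k + 1))
        have h3 := pow_nonneg (hx k).le p
        have h4 := pow_nonneg hA p
        by_cases h : A < x k
        · rw [Set.indicator_of_mem (show x k ∈ Set.Ioi A from h)]
          nlinarith
        · rw [Set.indicator_of_notMem (show x k ∉ Set.Ioi A from h)]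
          have : x k ^ p ≤ A ^ p := pow_le_pow_left₀ (hx k).le (not_lt.1 h) p
          nlinarith
    _ ≤ _ := by
        rw [Finset.sum_add_distrib, ← Finset.mul_sum]
        have := mul_le_mul_of_nonneg_left (sum_increments_le (x := x) hg0 t n) (pow_nonneg hA p)
        linarith

/-- Cauchy–Schwarz with the drops of `g` as weights; their total mass telescopes to at most `g t`.
-/
theorem sum_mul_increments_sq_le (hg : Monotone g) (hg0 : ∀ t, 0 ≤ g t) (hx : ∀ k, 0 < x k)
    (t : ℝ) (n : ℕ) :
    (∑ k ∈ Finset.range n, x k * (g (t - walk x k) - g (t - walk x (k + 1)))) ^ 2 ≤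
      g t * ∑ k ∈ Finset.range n, x k ^ 2 * (g (t - walk x k) - g (t - walk x (k + 1))) := by
  have hd : ∀ k, 0 ≤ g (t - walk x k) - g (t - walk x (k + 1)) :=
    fun k => sub_nonneg.2 (comp_sub_walk_succ_le hg hx t k)
  calc _ ≤ (∑ k ∈ Finset.range n, (g (t - walk x k) - g (t - walk x (k + 1)))) *
        ∑ k ∈ Finset.range n, x k ^ 2 * (g (t - walk x k) - g (t - walk x (k + 1))) := by
        refine Finset.sum_sq_le_sum_mul_sum_of_sq_le_mul _ (fun k _ => hd k)
          (fun k _ => mul_nonneg (sq_nonneg _) (hd k)) (fun k _ => le_of_eq (by ring))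
    _ ≤ _ := mul_le_mul_of_nonneg_right (sum_increments_le hg0 t n)
        (Finset.sum_nonneg fun k _ => mul_nonneg (sq_nonneg _) (hd k))

theorem integral_comp_sub_eq_of_le (hg : Monotone g) (hneg : ∀ t < 0, g t = 0) {t s : ℝ}
    (hs : t ≤ s) : ∫ u in (0 : ℝ)..s, g (t - u) = ∫ u in (0 : ℝ)..t, g u := by
  rw [← intervalIntegral.integral_add_adjacent_intervals
    (intervalIntegrable_comp_sub hg t 0 t) (intervalIntegrable_comp_sub hg t t s)]
  have : ∫ u in t..s, g (t - u) = 0 := by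
    rw [intervalIntegral.integral_congr_ae (g := fun _ => 0)]
    · simp
    · refine Eventually.of_forall fun u hu => hneg _ ?_
      rw [Set.uIoc_of_le hs] at hu
      linarith [hu.1]
  rw [this, add_zero, intervalIntegral.integral_comp_sub_left (fun u => g u)]
  simp

theorem integral_comp_sub_le (hg : Monotone g) (hg0 : ∀ t, 0 ≤ g t) (hneg : ∀ t < 0, g t = 0)
    (t s : ℝ) :
    ∫ u in (0 : ℝ)..s, g (t - u) ≤ ∫ u in (0 : ℝ)..t, g u := by
  rw [← integral_comp_sub_eq_of_le hg hneg (le_max_left t s),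
    ← intervalIntegral.integral_add_adjacent_intervals
    (intervalIntegrable_comp_sub hg t 0 s) (intervalIntegrable_comp_sub hg t s (max t s))]
  have := intervalIntegral.integral_nonneg (μ := volume) (le_max_right t s)
    (fun u _ => hg0 (t - u))
  linarith

theorem integral_comp_sub_nonneg (hg0 : ∀ t, 0 ≤ g t) {t s : ℝ} (hs : 0 ≤ s) :
    0 ≤ ∫ u in (0 : ℝ)..s, g (t - u) :=
  intervalIntegral.integral_nonneg (μ := volume) hs (fun u _ => hg0 (t - u))

/-- The discrete integration by parts behind all estimates. -/
theorem mul_sum_walk_eq (m t : ℝ) (n : ℕ) :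
    m * ∑ k ∈ Finset.range n, g (t - walk x (k + 1)) =
      (∑ k ∈ Finset.range n, x k * g (t - walk x k)) -
        (∑ k ∈ Finset.range n, (x k - m) * g (t - walk x k)) - m * g t +
          m * g (t - walk x n) := by
  induction n with
  | zero => simp
  | succ n ih =>
    simp only [Finset.sum_range_succ, mul_add, ih]
    ring

end Deterministic

/-! ### Step laws and i.i.d. sequences -/

/-- Laws of positive steps with finite second moment. -/
structure IsStepLaw (ν : Measure ℝ) : Prop where
  pos : ∀ᵐ y ∂ν, 0 < y
  memLp : MemLp id 2 ν

/-- Nonnegative monotone functions that vanish on the negative half-line. -/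
structure IsRenewalWeight (g : ℝ → ℝ) : Prop where
  mono : Monotone g
  nonneg : ∀ t, 0 ≤ g t
  neg : ∀ t < 0, g t = 0

theorem IsRenewalWeight.sq {g : ℝ → ℝ} (hg : IsRenewalWeight g) :
    IsRenewalWeight (fun t => g t ^ 2) where
  mono _ _ h := pow_le_pow_left₀ (hg.nonneg _) (hg.mono h) 2
  nonneg _ := sq_nonneg _
  neg t ht := by simp [hg.neg t ht]

/-- The law of an i.i.d. sequence of steps. -/
noncomputable abbrev stepMeasure (ν : Measure ℝ) [IsProbabilityMeasure ν] : Measure (ℕ → ℝ) :=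
  Measure.infinitePi fun _ => ν

/-- The truncated moment `E[ξ ^ p; ξ > A]`. -/
noncomputable def tailMoment (ν : Measure ℝ) (p : ℕ) (A : ℝ) : ℝ :=
  ∫ y, (Set.Ioi A).indicator (· ^ p) y ∂ν

section Step

variable {ν : Measure ℝ} [IsProbabilityMeasure ν]

theorem IsStepLaw.integrable_pow (hν : IsStepLaw ν) {p : ℕ} (hp : p ≤ 2) :
    Integrable (fun y => y ^ p) ν := by
  interval_cases p
  · simp
  · simpa [Function.id_def] using hν.memLp.integrable one_le_two
  · exact hν.memLp.integrable_sq

theorem IsStepLaw.integrable_id (hν : IsStepLaw ν) : Integrable (fun y => y) ν := by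
  simpa using hν.integrable_pow one_le_two

theorem IsStepLaw.integral_pos (hν : IsStepLaw ν) : 0 < ∫ y, y ∂ν := by
  rw [integral_pos_iff_support_of_nonneg_ae (hν.pos.mono fun _ h => h.le) hν.integrable_id]
  have h : ν (Function.support fun y : ℝ => y)ᶜ = 0 :=
    mem_ae_iff.1 (hν.pos.mono fun _ h => h.ne')
  rw [(prob_compl_eq_zero_iff (s := Function.support fun y : ℝ => y)
    (measurableSet_support measurable_id)).1 h]
  exact one_pos

omit [IsProbabilityMeasure ν] in
theorem integral_sub_integral_sq :
    ∫ y, (y - ∫ z, z ∂ν) ^ 2 ∂ν = Var[id; ν] := by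
  rw [variance_eq_integral measurable_id.aemeasurable]
  rfl

theorem IsStepLaw.integrable_tail (hν : IsStepLaw ν) {p : ℕ} (hp : p ≤ 2) (A : ℝ) :
    Integrable ((Set.Ioi A).indicator (· ^ p)) ν :=
  (hν.integrable_pow hp).indicator measurableSet_Ioi

theorem IsStepLaw.tendsto_tailMoment (hν : IsStepLaw ν) {p : ℕ} (hp : p ≤ 2) :
    Tendsto (tailMoment ν p) atTop (𝓝 0) := by
  have := tendsto_integral_filter_of_dominated_convergence (μ := ν) (l := (atTop : Filter ℝ))
    (F := fun A y => (Set.Ioi A).indicator (· ^ p) y) (f := fun _ => 0) (fun y => ‖y ^ p‖)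
    (Eventually.of_forall fun A => (hν.integrable_tail hp A).aestronglyMeasurable)
    (Eventually.of_forall fun A => Eventually.of_forall fun y => norm_indicator_le_norm_self _ _)
    (hν.integrable_pow hp).norm
    (Eventually.of_forall fun y => tendsto_const_nhds.congr' <| by
      filter_upwards [eventually_ge_atTop y] with A hA
      simp [hA])
  rw [integral_zero] at this
  exact this

omit [IsProbabilityMeasure ν] in
theorem IsStepLaw.tailMoment_nonneg (hν : IsStepLaw ν) (p : ℕ) (A : ℝ) : 0 ≤ tailMoment ν p A := by
  refine integral_nonneg_of_ae ?_
  filter_upwards [hν.pos] with y hy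
  exact Set.indicator_apply_nonneg fun _ => pow_nonneg hy.le _

theorem IsStepLaw.ae_pos (hν : IsStepLaw ν) : ∀ᵐ x ∂stepMeasure ν, ∀ k, 0 < x k :=
  ae_all_iff.2 fun k =>
    (measurePreserving_eval_infinitePi (fun _ : ℕ => ν) k).quasiMeasurePreserving.ae hν.pos

theorem iIndepFun_eval : iIndepFun (fun (k : ℕ) (x : ℕ → ℝ) => x k) (stepMeasure ν) :=
  iIndepFun_infinitePi (X := fun _ y => y) (fun _ => measurable_id)

/-- Extending the first `k` coordinates by zeros does not change `h`, so `h` factors through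
finitely many coordinates, all different from `k`. -/
theorem indepFun_of_depends {β : Type*} [MeasurableSpace β] {h : (ℕ → ℝ) → β} (hm : Measurable h)
    {k : ℕ} (hd : ∀ x y : ℕ → ℝ, (∀ i < k, x i = y i) → h x = h y) :
    IndepFun (fun x => x k) h (stepMeasure ν) := by
  have h1 := (iIndepFun_eval (ν := ν)).indepFun_finset {k} (Finset.range k) (by simp)
    (fun i => measurable_pi_apply i)
  have hk : Measurable fun z : ({k} : Finset ℕ) → ℝ => z ⟨k, by simp⟩ := by fun_prop
  have h2 := h1.comp (φ := fun z : ({k} : Finset ℕ) → ℝ => z ⟨k, by simp⟩)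
    (ψ := fun z : Finset.range k → ℝ => h fun i => if hi : i ∈ Finset.range k then z ⟨i, hi⟩ else 0)
    hk (hm.comp (measurable_pi_lambda _ fun i => by
      by_cases hi : i ∈ Finset.range k
      · simp only [hi, dite_true]; exact measurable_pi_apply _
      · simp only [hi, dite_false]; exact measurable_const))
  refine h2.congr (ae_of_all _ fun x => rfl) (ae_of_all _ fun x => ?_)
  refine hd _ _ fun i hi => ?_
  simp [hi]

theorem integral_comp_eval (k : ℕ) {φ : ℝ → ℝ} (hφ : Measurable φ) :
    ∫ x, φ (x k) ∂stepMeasure ν = ∫ y, φ y ∂ν := by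
  have mp := measurePreserving_eval_infinitePi (fun _ : ℕ => ν) k
  have := integral_map (μ := stepMeasure ν) mp.measurable.aemeasurable
    hφ.aestronglyMeasurable
  rw [mp.map_eq] at this
  exact this.symm

theorem integrable_mul_of_depends {h : (ℕ → ℝ) → ℝ} (hm : Measurable h) {k : ℕ}
    (hd : ∀ x y : ℕ → ℝ, (∀ i < k, x i = y i) → h x = h y) {φ : ℝ → ℝ} (hφ : Measurable φ)
    (hφi : Integrable φ ν) (hi : Integrable h (stepMeasure ν)) :
    Integrable (fun x => φ (x k) * h x) (stepMeasure ν) := by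
  have mp := measurePreserving_eval_infinitePi (fun _ : ℕ => ν) k
  exact ((indepFun_of_depends hm hd).comp hφ measurable_id).integrable_mul
    (mp.integrable_comp_of_integrable hφi) hi

theorem integral_mul_of_depends {h : (ℕ → ℝ) → ℝ} (hm : Measurable h) {k : ℕ}
    (hd : ∀ x y : ℕ → ℝ, (∀ i < k, x i = y i) → h x = h y) {φ : ℝ → ℝ} (hφ : Measurable φ) :
    ∫ x, φ (x k) * h x ∂stepMeasure ν = (∫ y, φ y ∂ν) * ∫ x, h x ∂stepMeasure ν := by
  have := ((indepFun_of_depends (ν := ν) hm hd).comp hφ measurable_id).integral_fun_mul_eq_mul_integral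
    (hφ.comp (measurable_pi_apply k)).aestronglyMeasurable hm.aestronglyMeasurable
  simp only [Function.comp, id] at this
  rw [this, integral_comp_eval k hφ]

@[fun_prop]
theorem measurable_walk (n : ℕ) : Measurable fun x => walk x n := by
  unfold walk; fun_prop

theorem walk_congr {x y : ℕ → ℝ} {k : ℕ} (h : ∀ i < k, x i = y i) : walk x k = walk y k :=
  Finset.sum_congr rfl fun i hi => h i (Finset.mem_range.1 hi)

/-- By the strong law `S_n / n` tends to a positive mean. -/
theorem IsStepLaw.tendsto_walk (hν : IsStepLaw ν) :
    ∀ᵐ x ∂stepMeasure ν, Tendsto (walk x) atTop atTop := by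
  have mp := measurePreserving_eval_infinitePi (fun _ : ℕ => ν)
  have hint : Integrable (fun x : ℕ → ℝ => x 0) (stepMeasure ν) :=
    (mp 0).integrable_comp_of_integrable hν.integrable_id
  have h := strong_law_ae_real (fun (k : ℕ) (x : ℕ → ℝ) => x k) hint
    (fun i j hij => iIndepFun_eval.indepFun hij)
    (fun i => ⟨(measurable_pi_apply i).aemeasurable, (measurable_pi_apply 0).aemeasurable,
      (mp i).map_eq.trans (mp 0).map_eq.symm⟩)
  have hm := integral_comp_eval (ν := ν) 0 measurable_id
  simp only [id] at hm
  filter_upwards [h] with x hx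
  rw [hm] at hx
  have := hx.pos_mul_atTop hν.integral_pos tendsto_natCast_atTop_atTop
  refine this.congr' ?_
  filter_upwards [eventually_gt_atTop 0] with n hn
  have : (n : ℝ) ≠ 0 := by exact_mod_cast hn.ne'
  simp only [walk]
  field_simp

end Step

/-! ### Martingale decomposition of truncated sums -/

section Moments

variable {ν : Measure ℝ} [IsProbabilityMeasure ν] {g : ℝ → ℝ}

/-- `∑_{1 ≤ k ≤ n} g (t - S_k)`. -/
def walkSum (g : ℝ → ℝ) (t : ℝ) (n : ℕ) (x : ℕ → ℝ) : ℝ :=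
  ∑ k ∈ Finset.range n, g (t - walk x (k + 1))

/-- The martingale `∑_{k < n} (ξ_{k+1} - E ξ) g (t - S_k)`. -/
noncomputable def walkMart (ν : Measure ℝ) (g : ℝ → ℝ) (t : ℝ) (n : ℕ) (x : ℕ → ℝ) : ℝ :=
  ∑ k ∈ Finset.range n, (x k - ∫ y, y ∂ν) * g (t - walk x k)

/-- The error of the Riemann sum `∑_{k < n} ξ_{k+1} g (t - S_k)`. -/
noncomputable def walkErr (g : ℝ → ℝ) (t : ℝ) (n : ℕ) (x : ℕ → ℝ) : ℝ :=
  (∑ k ∈ Finset.range n, x k * g (t - walk x k)) - ∫ u in (0 : ℝ)..walk x n, g (t - u)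

omit [IsProbabilityMeasure ν] in
theorem mul_walkSum_eq (t : ℝ) (n : ℕ) (x : ℕ → ℝ) :
    (∫ y, y ∂ν) * walkSum g t n x =
      walkErr g t n x + (∫ u in (0 : ℝ)..walk x n, g (t - u)) - walkMart ν g t n x
        - (∫ y, y ∂ν) * g t + (∫ y, y ∂ν) * g (t - walk x n) := by
  simp only [walkSum, walkErr, walkMart, mul_sum_walk_eq]
  ring

theorem IsRenewalWeight.measurable_comp_walk (hg : IsRenewalWeight g) (t : ℝ) (k : ℕ) :
    Measurable fun x => g (t - walk x k) :=
  hg.mono.measurable.comp (by fun_prop)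

theorem IsRenewalWeight.measurable_walkSum (hg : IsRenewalWeight g) (t : ℝ) (n : ℕ) :
    Measurable (walkSum g t n) :=
  Finset.measurable_fun_sum _ fun _ _ => hg.measurable_comp_walk t _

omit [IsProbabilityMeasure ν] in
theorem IsRenewalWeight.measurable_walkMart (hg : IsRenewalWeight g) (t : ℝ) (n : ℕ) :
    Measurable (walkMart ν g t n) :=
  Finset.measurable_fun_sum _ fun k _ =>
    ((measurable_pi_apply k).sub_const _).mul (hg.measurable_comp_walk t k)

theorem IsRenewalWeight.measurable_integral_walk (hg : IsRenewalWeight g) (t : ℝ) (n : ℕ) :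
    Measurable fun x => ∫ u in (0 : ℝ)..walk x n, g (t - u) :=
  (intervalIntegral.continuous_primitive (intervalIntegrable_comp_sub hg.mono t) 0).measurable.comp
    (measurable_walk n)

theorem IsRenewalWeight.comp_walk_le (hg : IsRenewalWeight g) {x : ℕ → ℝ} (hx : ∀ k, 0 < x k)
    (t : ℝ) (k : ℕ) : g (t - walk x k) ≤ g t :=
  hg.mono (by linarith [walk_nonneg hx k])

theorem IsRenewalWeight.ae_norm_comp_walk_le (hg : IsRenewalWeight g) (hν : IsStepLaw ν)
    (t : ℝ) (k : ℕ) : ∀ᵐ x ∂stepMeasure ν, ‖g (t - walk x k)‖ ≤ g t := by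
  filter_upwards [hν.ae_pos] with x hx
  rw [Real.norm_of_nonneg (hg.nonneg _)]
  exact hg.comp_walk_le hx t k

theorem IsRenewalWeight.memLp_comp_walk (hg : IsRenewalWeight g) (hν : IsStepLaw ν)
    (t : ℝ) (k : ℕ) (p : ENNReal) : MemLp (fun x => g (t - walk x k)) p (stepMeasure ν) :=
  MemLp.of_bound (hg.measurable_comp_walk t k).aestronglyMeasurable _
    (hg.ae_norm_comp_walk_le hν t k)

theorem IsRenewalWeight.integrable_comp_walk (hg : IsRenewalWeight g) (hν : IsStepLaw ν)
    (t : ℝ) (k : ℕ) : Integrable (fun x => g (t - walk x k)) (stepMeasure ν) :=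
  (hg.memLp_comp_walk hν t k 1).integrable le_rfl

theorem IsStepLaw.memLp_eval (hν : IsStepLaw ν) (k : ℕ) :
    MemLp (fun x : ℕ → ℝ => x k) 2 (stepMeasure ν) :=
  hν.memLp.comp_measurePreserving (measurePreserving_eval_infinitePi (fun _ : ℕ => ν) k)

theorem IsRenewalWeight.memLp_walkSum (hg : IsRenewalWeight g) (hν : IsStepLaw ν)
    (t : ℝ) (n : ℕ) : MemLp (walkSum g t n) 2 (stepMeasure ν) :=
  memLp_finsetSum _ fun k _ => hg.memLp_comp_walk hν t (k + 1) 2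

theorem memLp_mul_comp_walk (hg : IsRenewalWeight g) (hν : IsStepLaw ν) (t : ℝ) (k : ℕ)
    {h : (ℕ → ℝ) → ℝ} (hh : MemLp h 2 (stepMeasure ν)) :
    MemLp (fun x => h x * g (t - walk x k)) 2 (stepMeasure ν) := by
  refine (hh.const_mul (g t)).mono
    (hh.1.mul (hg.measurable_comp_walk t k).aestronglyMeasurable) ?_
  filter_upwards [hg.ae_norm_comp_walk_le hν t k] with x hx
  rw [norm_mul, norm_mul, mul_comm, Real.norm_of_nonneg (hg.nonneg t)]
  gcongr

theorem IsRenewalWeight.memLp_walkMart (hg : IsRenewalWeight g) (hν : IsStepLaw ν)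
    (t : ℝ) (n : ℕ) : MemLp (walkMart ν g t n) 2 (stepMeasure ν) :=
  memLp_finsetSum _ fun k _ =>
    memLp_mul_comp_walk hg hν t k ((hν.memLp_eval k).sub (memLp_const _))

theorem IsRenewalWeight.memLp_integral_walk (hg : IsRenewalWeight g) (hν : IsStepLaw ν)
    (t : ℝ) (n : ℕ) (p : ENNReal) :
    MemLp (fun x => ∫ u in (0 : ℝ)..walk x n, g (t - u)) p (stepMeasure ν) := by
  refine MemLp.of_bound (hg.measurable_integral_walk t n).aestronglyMeasurable
    (∫ u in (0 : ℝ)..t, g u) ?_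
  filter_upwards [hν.ae_pos] with x hx
  rw [Real.norm_of_nonneg (integral_comp_sub_nonneg hg.nonneg (walk_nonneg hx n))]
  exact integral_comp_sub_le hg.mono hg.nonneg hg.neg t _

theorem IsRenewalWeight.memLp_walkErr (hg : IsRenewalWeight g) (hν : IsStepLaw ν)
    (t : ℝ) (n : ℕ) : MemLp (walkErr g t n) 2 (stepMeasure ν) :=
  (memLp_finsetSum _ fun k _ => memLp_mul_comp_walk hg hν t k (hν.memLp_eval k)).sub
    (hg.memLp_integral_walk hν t n 2)

theorem depends_comp_walk (t : ℝ) (k : ℕ) (x y : ℕ → ℝ) (h : ∀ i < k, x i = y i) :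
    g (t - walk x k) = g (t - walk y k) := by rw [walk_congr h]

theorem integral_centered (hν : IsStepLaw ν) : ∫ z, (z - ∫ y, y ∂ν) ∂ν = 0 := by
  rw [integral_sub hν.integrable_id (integrable_const _)]
  simp

theorem IsRenewalWeight.integral_walkMart (hg : IsRenewalWeight g) (hν : IsStepLaw ν)
    (t : ℝ) (n : ℕ) : ∫ x, walkMart ν g t n x ∂stepMeasure ν = 0 := by
  unfold walkMart
  rw [integral_finsetSum]
  · refine Finset.sum_eq_zero fun k _ => ?_
    rw [integral_mul_of_depends (φ := fun z => z - ∫ y, y ∂ν) (hg.measurable_comp_walk t k)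
      (depends_comp_walk t k) (by fun_prop), integral_centered hν, zero_mul]
  · exact fun k _ => (memLp_mul_comp_walk hg hν t k
      ((hν.memLp_eval k).sub (memLp_const _))).integrable one_le_two

omit [IsProbabilityMeasure ν] in
theorem depends_walkMart (t : ℝ) (k : ℕ) (x y : ℕ → ℝ) (h : ∀ i < k, x i = y i) :
    walkMart ν g t k x = walkMart ν g t k y :=
  Finset.sum_congr rfl fun i hi => by
    have hi := Finset.mem_range.1 hi
    rw [h i hi, walk_congr fun j hj => h j (hj.trans hi)]

/-- Martingale increments are orthogonal, and each centered step is independent of the walk before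
it. -/
theorem IsRenewalWeight.integral_walkMart_sq (hg : IsRenewalWeight g) (hν : IsStepLaw ν)
    (t : ℝ) (n : ℕ) : ∫ x, walkMart ν g t n x ^ 2 ∂stepMeasure ν =
      Var[id; ν] * ∑ k ∈ Finset.range n, ∫ x, g (t - walk x k) ^ 2 ∂stepMeasure ν := by
  induction n with
  | zero => simp [walkMart]
  | succ n ih =>
    have hc := (hν.memLp_eval n).sub (memLp_const (∫ y, y ∂ν))
    have hinc := memLp_mul_comp_walk hg hν t n hc
    -- The cross term vanishes: the second factor depends only on the steps before `n`, and the
    -- first is centered.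
    have h1 : ∫ x, (x n - ∫ y, y ∂ν) * (2 * walkMart ν g t n x * g (t - walk x n))
        ∂stepMeasure ν = 0 := by
      rw [integral_mul_of_depends (φ := fun z => z - ∫ y, y ∂ν)
        (h := fun x => 2 * walkMart ν g t n x * g (t - walk x n)) (((hg.measurable_walkMart t n).const_mul 2).mul (hg.measurable_comp_walk t n)) ?_
        (by fun_prop), integral_centered hν, zero_mul]
      intro x y h
      simp only [walk_congr h, depends_walkMart t n x y h]
    have h2 : ∫ x, (x n - ∫ y, y ∂ν) ^ 2 * g (t - walk x n) ^ 2 ∂stepMeasure ν =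
        Var[id; ν] * ∫ x, g (t - walk x n) ^ 2 ∂stepMeasure ν := by
      rw [integral_mul_of_depends (φ := fun z => (z - ∫ y, y ∂ν) ^ 2)
        ((hg.measurable_comp_walk t n).pow_const 2) ?_ (by fun_prop), integral_sub_integral_sq]
      intro x y h
      simp only [walk_congr h]
    have i0 := (hg.memLp_walkMart hν t n).integrable_sq
    have i1 : Integrable (fun x => (x n - ∫ y, y ∂ν) *
        (2 * walkMart ν g t n x * g (t - walk x n))) (stepMeasure ν) := by
      refine ((hinc.integrable_mul (hg.memLp_walkMart hν t n)).const_mul 2).congr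
        (Eventually.of_forall fun x => ?_)
      simp only [Pi.mul_apply, Pi.sub_apply]
      ring
    have i2 : Integrable (fun x => (x n - ∫ y, y ∂ν) ^ 2 * g (t - walk x n) ^ 2)
        (stepMeasure ν) :=
      hinc.integrable_sq.congr (Eventually.of_forall fun x => by
        simp only [Pi.sub_apply]; ring)
    have e : ∀ x, walkMart ν g t (n + 1) x ^ 2 = walkMart ν g t n x ^ 2 +
        (x n - ∫ y, y ∂ν) * (2 * walkMart ν g t n x * g (t - walk x n)) +
        (x n - ∫ y, y ∂ν) ^ 2 * g (t - walk x n) ^ 2 := fun x => by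
      simp only [walkMart, Finset.sum_range_succ]
      ring
    have i01 : Integrable (fun x => walkMart ν g t n x ^ 2 +
        (x n - ∫ y, y ∂ν) * (2 * walkMart ν g t n x * g (t - walk x n))) (stepMeasure ν) :=
      i0.add i1
    simp_rw [e]
    rw [integral_add i01 i2, integral_add i0 i1, h1, h2, ih, Finset.sum_range_succ]
    ring

end Moments

/-! ### Bounds uniform in the truncation, and its removal -/

section Bounds

variable {ν : Measure ℝ} [IsProbabilityMeasure ν] {g : ℝ → ℝ}

/-- The sums in the martingale and the error start at `S_0 = 0`, while `walkSum` starts at `S_1`;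
the extra term is `g t`. -/
theorem IsRenewalWeight.sum_comp_walk_le (hg : IsRenewalWeight g) (t : ℝ) (n : ℕ) (x : ℕ → ℝ) :
    ∑ k ∈ Finset.range n, g (t - walk x k) ≤ g t + walkSum g t n x := by
  calc _ ≤ ∑ k ∈ Finset.range (n + 1), g (t - walk x k) :=
        Finset.sum_le_sum_of_subset_of_nonneg (by simp) fun _ _ _ => hg.nonneg _
    _ = _ := by rw [Finset.sum_range_succ', walkSum, walk_zero, sub_zero, add_comm]

theorem IsRenewalWeight.sum_integral_comp_walk_le (hg : IsRenewalWeight g) (hν : IsStepLaw ν)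
    (t : ℝ) (n : ℕ) : ∑ k ∈ Finset.range n, ∫ x, g (t - walk x k) ∂stepMeasure ν ≤
      g t + ∫ x, walkSum g t n x ∂stepMeasure ν := by
  have hi := (hg.memLp_walkSum hν t n).integrable one_le_two
  rw [← integral_finsetSum _ fun k _ => hg.integrable_comp_walk hν t k]
  calc _ ≤ ∫ x, (g t + walkSum g t n x) ∂stepMeasure ν :=
        integral_mono (integrable_finsetSum _ fun k _ => hg.integrable_comp_walk hν t k)
          ((integrable_const _).add hi) (hg.sum_comp_walk_le t n)
    _ = _ := by rw [integral_add (integrable_const _) hi]; simp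

theorem IsRenewalWeight.integrable_tail_comp_walk (hg : IsRenewalWeight g) (hν : IsStepLaw ν)
    (t : ℝ) (k : ℕ) {p : ℕ} (hp : p ≤ 2) (A : ℝ) :
    Integrable (fun x => (Set.Ioi A).indicator (· ^ p) (x k) * g (t - walk x k))
      (stepMeasure ν) :=
  integrable_mul_of_depends (hg.measurable_comp_walk t k) (depends_comp_walk t k)
    ((measurable_id.pow_const p).indicator measurableSet_Ioi) (hν.integrable_tail hp A)
    (hg.integrable_comp_walk hν t k)

theorem IsRenewalWeight.integral_tail_le (hg : IsRenewalWeight g) (hν : IsStepLaw ν)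
    (t : ℝ) (n : ℕ) {p : ℕ} (hp : p ≤ 2) (A : ℝ) :
    ∫ x, (∑ k ∈ Finset.range n, (Set.Ioi A).indicator (· ^ p) (x k) * g (t - walk x k))
      ∂stepMeasure ν ≤ tailMoment ν p A * (g t + ∫ x, walkSum g t n x ∂stepMeasure ν) := by
  rw [integral_finsetSum _ fun k _ => hg.integrable_tail_comp_walk hν t k hp A]
  calc _ = ∑ k ∈ Finset.range n, tailMoment ν p A * ∫ x, g (t - walk x k) ∂stepMeasure ν :=
        Finset.sum_congr rfl fun k _ => integral_mul_of_depends (hg.measurable_comp_walk t k)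
          (depends_comp_walk t k) ((measurable_id.pow_const p).indicator measurableSet_Ioi)
    _ ≤ _ := by
        rw [← Finset.mul_sum]
        exact mul_le_mul_of_nonneg_left (hg.sum_integral_comp_walk_le hν t n)
          (hν.tailMoment_nonneg p A)

theorem IsRenewalWeight.walkErr_nonneg (hg : IsRenewalWeight g) {x : ℕ → ℝ} (hx : ∀ k, 0 < x k)
    (t : ℝ) (n : ℕ) : 0 ≤ walkErr g t n x :=
  sub_nonneg.2 (integral_le_sum_walk hg.mono hx t n)

theorem IsRenewalWeight.mul_walkSum_le (hg : IsRenewalWeight g) (hν : IsStepLaw ν) {x : ℕ → ℝ}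
    (hx : ∀ k, 0 < x k) (t : ℝ) (n : ℕ) :
    (∫ y, y ∂ν) * walkSum g t n x ≤
      walkErr g t n x + (∫ u in (0 : ℝ)..t, g u) - walkMart ν g t n x := by
  rw [mul_walkSum_eq]
  have h1 := mul_le_mul_of_nonneg_left (hg.comp_walk_le hx t n) hν.integral_pos.le
  have h2 := integral_comp_sub_le hg.mono hg.nonneg hg.neg t (walk x n)
  linarith

/-- The martingale has mean zero. The expectation of `walkSum` reappears on the right with a small
factor for large `A`, and can then be absorbed. -/
theorem IsRenewalWeight.mul_integral_walkSum_le (hg : IsRenewalWeight g) (hν : IsStepLaw ν)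
    (t : ℝ) (n : ℕ) {A : ℝ} (hA : 0 ≤ A) :
    (∫ y, y ∂ν) * ∫ x, walkSum g t n x ∂stepMeasure ν ≤ (∫ u in (0 : ℝ)..t, g u) + A * g t +
      tailMoment ν 1 A * (g t + ∫ x, walkSum g t n x ∂stepMeasure ν) := by
  have hi := (hg.memLp_walkSum hν t n).integrable one_le_two
  have hD := (hg.memLp_walkMart hν t n).integrable one_le_two
  have hT : Integrable (fun x => ∑ k ∈ Finset.range n,
      (Set.Ioi A).indicator (· ^ 1) (x k) * g (t - walk x k)) (stepMeasure ν) :=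
    integrable_finsetSum _ fun k _ => hg.integrable_tail_comp_walk hν t k one_le_two A
  have hTD : Integrable (fun x => (∑ k ∈ Finset.range n,
      (Set.Ioi A).indicator (· ^ 1) (x k) * g (t - walk x k)) - walkMart ν g t n x)
      (stepMeasure ν) := hT.sub hD
  have key : ∫ x, (∫ y, y ∂ν) * walkSum g t n x ∂stepMeasure ν ≤
      ∫ x, (((∫ u in (0 : ℝ)..t, g u) + A * g t) + ((∑ k ∈ Finset.range n,
        (Set.Ioi A).indicator (· ^ 1) (x k) * g (t - walk x k)) - walkMart ν g t n x))
        ∂stepMeasure ν := by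
    refine integral_mono_ae (hi.const_mul _) ((integrable_const _).add hTD) ?_
    filter_upwards [hν.ae_pos] with x hx
    have h1 := hg.mul_walkSum_le hν hx t n
    have h2 := sum_walk_sub_integral_le hg.mono hx t n
    have h3 := sum_pow_mul_increments_le hg.mono hg.nonneg hx t n 1 hA
    simp only [pow_one] at h3 ⊢
    rw [walkErr] at h1
    linarith
  rw [integral_const_mul, integral_add (integrable_const _) hTD, integral_sub hT hD,
    hg.integral_walkMart hν, integral_const] at key
  have := hg.integral_tail_le hν t n one_le_two A
  simp only [probReal_univ, one_smul] at key
  linarith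

theorem IsRenewalWeight.le_mul_integral_walkSum (hg : IsRenewalWeight g) (hν : IsStepLaw ν)
    (t : ℝ) (n : ℕ) :
    ∫ x, (∫ u in (0 : ℝ)..walk x n, g (t - u)) ∂stepMeasure ν - (∫ y, y ∂ν) * g t ≤
      (∫ y, y ∂ν) * ∫ x, walkSum g t n x ∂stepMeasure ν := by
  have hi := (hg.memLp_walkSum hν t n).integrable one_le_two
  have hD := (hg.memLp_walkMart hν t n).integrable one_le_two
  have hI := (hg.memLp_integral_walk hν t n 1).integrable le_rfl
  have hDc : Integrable (fun x => walkMart ν g t n x + (∫ y, y ∂ν) * g t) (stepMeasure ν) :=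
    hD.add (integrable_const _)
  have key : ∫ x, ((∫ u in (0 : ℝ)..walk x n, g (t - u)) -
      (walkMart ν g t n x + (∫ y, y ∂ν) * g t)) ∂stepMeasure ν ≤
      ∫ x, (∫ y, y ∂ν) * walkSum g t n x ∂stepMeasure ν := by
    refine integral_mono_ae (hI.sub hDc) (hi.const_mul _) ?_
    filter_upwards [hν.ae_pos] with x hx
    have h1 := hg.walkErr_nonneg hx t n
    have h2 := mul_nonneg hν.integral_pos.le (hg.nonneg (t - walk x n))
    rw [mul_walkSum_eq]
    linarith
  rw [integral_const_mul, integral_sub hI hDc,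
    integral_add hD (integrable_const _), hg.integral_walkMart hν, integral_const] at key
  simpa using key

theorem IsRenewalWeight.integral_walkErr_sq_le (hg : IsRenewalWeight g) (hν : IsStepLaw ν)
    (t : ℝ) (n : ℕ) {A : ℝ} (hA : 0 ≤ A) :
    ∫ x, walkErr g t n x ^ 2 ∂stepMeasure ν ≤
      g t * (A ^ 2 * g t +
        tailMoment ν 2 A * (g t + ∫ x, walkSum g t n x ∂stepMeasure ν)) := by
  have hT : Integrable (fun x => ∑ k ∈ Finset.range n,
      (Set.Ioi A).indicator (· ^ 2) (x k) * g (t - walk x k)) (stepMeasure ν) :=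
    integrable_finsetSum _ fun k _ => hg.integrable_tail_comp_walk hν t k le_rfl A
  calc _ ≤ ∫ x, g t * (A ^ 2 * g t + ∑ k ∈ Finset.range n,
        (Set.Ioi A).indicator (· ^ 2) (x k) * g (t - walk x k)) ∂stepMeasure ν := by
        refine integral_mono_ae (hg.memLp_walkErr hν t n).integrable_sq
          (((integrable_const _).add hT).const_mul _) ?_
        filter_upwards [hν.ae_pos] with x hx
        calc _ ≤ _ := pow_le_pow_left₀ (hg.walkErr_nonneg hx t n)
              (sum_walk_sub_integral_le hg.mono hx t n) 2
          _ ≤ _ := sum_mul_increments_sq_le hg.mono hg.nonneg hx t n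
          _ ≤ _ := mul_le_mul_of_nonneg_left
              (sum_pow_mul_increments_le hg.mono hg.nonneg hx t n 2 hA) (hg.nonneg t)
    _ ≤ _ := by
        rw [integral_const_mul, integral_add (integrable_const _) hT, integral_const]
        refine mul_le_mul_of_nonneg_left ?_ (hg.nonneg t)
        have := hg.integral_tail_le hν t n le_rfl A
        simpa using this

theorem IsRenewalWeight.exists_integral_walkSum_le (hg : IsRenewalWeight g) (hν : IsStepLaw ν)
    (t : ℝ) : ∃ K, ∀ n, ∫ x, walkSum g t n x ∂stepMeasure ν ≤ K := by
  obtain ⟨A, hA, hA0⟩ := (((hν.tendsto_tailMoment one_le_two).eventually_lt_const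
    hν.integral_pos).and (eventually_ge_atTop 0)).exists
  refine ⟨((∫ u in (0 : ℝ)..t, g u) + A * g t + tailMoment ν 1 A * g t) /
    ((∫ y, y ∂ν) - tailMoment ν 1 A), fun n => ?_⟩
  rw [le_div_iff₀ (sub_pos.2 hA)]
  have := hg.mul_integral_walkSum_le hν t n hA0
  linarith

theorem IsRenewalWeight.walkSum_nonneg (hg : IsRenewalWeight g) (t : ℝ) (n : ℕ) (x : ℕ → ℝ) :
    0 ≤ walkSum g t n x :=
  Finset.sum_nonneg fun _ _ => hg.nonneg _

theorem IsRenewalWeight.exists_integral_walkSum_sq_le (hg : IsRenewalWeight g)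
    (hν : IsStepLaw ν) (t : ℝ) :
    ∃ K, ∀ n, ∫ x, walkSum g t n x ^ 2 ∂stepMeasure ν ≤ K := by
  obtain ⟨K₁, h₁⟩ := hg.exists_integral_walkSum_le hν t
  obtain ⟨K₂, h₂⟩ := hg.sq.exists_integral_walkSum_le hν t
  set m := ∫ y, y ∂ν
  have hm : 0 < m := hν.integral_pos
  set G := ∫ u in (0 : ℝ)..t, g u
  -- The three summands bound the second moments of error, integral and martingale. The error bound
  -- is used with `A = 0`, where the tail moment is the full second moment.
  refine ⟨3 * (g t * (0 ^ 2 * g t + tailMoment ν 2 0 * (g t + K₁)) + G ^ 2 +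
    Var[id; ν] * (g t ^ 2 + K₂)) / m ^ 2, fun n => ?_⟩
  rw [le_div_iff₀ (by positivity)]
  have i0 := (hg.memLp_walkSum hν t n).integrable_sq
  have i1 := (hg.memLp_walkErr hν t n).integrable_sq
  have i2 := (hg.memLp_walkMart hν t n).integrable_sq
  have i3 : Integrable (fun x => walkErr g t n x ^ 2 + walkMart ν g t n x ^ 2)
    (stepMeasure ν) := i1.add i2
  have key : ∫ x, walkSum g t n x ^ 2 * m ^ 2 ∂stepMeasure ν ≤
      ∫ x, 3 * ((walkErr g t n x ^ 2 + walkMart ν g t n x ^ 2) + G ^ 2) ∂stepMeasure ν := by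
    refine integral_mono_ae (i0.mul_const _) ((i3.add (integrable_const _)).const_mul _) ?_
    filter_upwards [hν.ae_pos] with x hx
    have h1 : m * walkSum g t n x ≤ _ := hg.mul_walkSum_le hν hx t n
    have h2 := mul_nonneg hm.le (hg.walkSum_nonneg t n x)
    have h3 := pow_le_pow_left₀ h2 h1 2
    -- With `a`, `b`, `c` the error, integral and martingale, `3(a² + b² + c²) - (a + b - c)²` is
    -- the sum of the three squares supplied.
    nlinarith [sq_nonneg (walkErr g t n x - G), sq_nonneg (walkErr g t n x + walkMart ν g t n x),
      sq_nonneg (G + walkMart ν g t n x)]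
  rw [integral_mul_const, integral_const_mul, integral_add i3 (integrable_const _),
    integral_add i1 i2, hg.integral_walkMart_sq hν, integral_const] at key
  have e1 := hg.integral_walkErr_sq_le hν t n le_rfl
  have e2 := hg.sq.sum_integral_comp_walk_le hν t n
  have e3 := mul_le_mul_of_nonneg_left (e2.trans (add_le_add_right (h₂ n) _))
    (variance_nonneg id ν)
  have e4 : g t * (0 ^ 2 * g t + tailMoment ν 2 0 * (g t + ∫ x, walkSum g t n x ∂stepMeasure ν)) ≤
      g t * (0 ^ 2 * g t + tailMoment ν 2 0 * (g t + K₁)) := by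
    have := hg.nonneg t
    have := hν.tailMoment_nonneg 2 0
    gcongr
    exact h₁ n
  simp only [probReal_univ, one_smul] at key
  linarith

/-- `∑_{k ≥ 1} g (t - S_k)`. -/
noncomputable def walkTotal (g : ℝ → ℝ) (t : ℝ) (x : ℕ → ℝ) : ℝ :=
  ∑' k, g (t - walk x (k + 1))

theorem IsRenewalWeight.summable_walk (hg : IsRenewalWeight g) (t : ℝ) {x : ℕ → ℝ}
    (hx : Tendsto (walk x) atTop atTop) : Summable fun k => g (t - walk x (k + 1)) := by
  obtain ⟨N, hN⟩ := eventually_atTop.1 (hx.eventually_gt_atTop t)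
  refine summable_of_ne_finset_zero (s := Finset.range N) fun k hk => ?_
  have := hN (k + 1) (by simp at hk; omega)
  exact hg.neg _ (by linarith)

theorem IsRenewalWeight.tendsto_walkSum (hg : IsRenewalWeight g) (t : ℝ) {x : ℕ → ℝ}
    (hx : Tendsto (walk x) atTop atTop) :
    Tendsto (fun n => walkSum g t n x) atTop (𝓝 (walkTotal g t x)) :=
  (hg.summable_walk t hx).hasSum.tendsto_sum_nat

theorem IsRenewalWeight.walkSum_le_walkTotal (hg : IsRenewalWeight g) (t : ℝ) (n : ℕ)
    {x : ℕ → ℝ} (hx : Tendsto (walk x) atTop atTop) : walkSum g t n x ≤ walkTotal g t x :=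
  (hg.summable_walk t hx).sum_le_tsum _ fun _ _ => hg.nonneg _

/-- Fatou's lemma applied to the squares. -/
theorem memLp_two_of_tendsto {α : Type*} [MeasurableSpace α] {μ : Measure α} {F : ℕ → α → ℝ}
    {f : α → ℝ} (hF : ∀ n, MemLp (F n) 2 μ)
    (hlim : ∀ᵐ x ∂μ, Tendsto (fun n => F n x) atTop (𝓝 (f x))) {K : ℝ}
    (hK : ∀ n, ∫ x, F n x ^ 2 ∂μ ≤ K) : MemLp f 2 μ := by
  have hm := aestronglyMeasurable_of_tendsto_ae _ (fun n => (hF n).1) hlim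
  rw [memLp_two_iff_integrable_sq hm]
  refine ⟨hm.pow 2, ?_⟩
  calc ∫⁻ x, ‖f x ^ 2‖ₑ ∂μ = ∫⁻ x, liminf (fun n => ‖F n x ^ 2‖ₑ) atTop ∂μ :=
        lintegral_congr_ae (hlim.mono fun x hx => ((hx.pow 2).enorm.liminf_eq).symm)
    _ ≤ liminf (fun n => ∫⁻ x, ‖F n x ^ 2‖ₑ ∂μ) atTop :=
        lintegral_liminf_le' fun n => ((hF n).1.pow 2).enorm
    _ ≤ liminf (fun _ : ℕ => ENNReal.ofReal K) atTop := by
        refine liminf_le_liminf (Eventually.of_forall fun n => ?_)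
        rw [← ofReal_integral_norm_eq_lintegral_enorm (hF n).integrable_sq]
        refine ENNReal.ofReal_le_ofReal ?_
        simpa using hK n
    _ < ⊤ := by simp

/-- The limit is square integrable and dominates its own partial sums, so their first two moments
converge. -/
theorem IsRenewalWeight.memLp_walkTotal (hg : IsRenewalWeight g) (hν : IsStepLaw ν) (t : ℝ) :
    MemLp (walkTotal g t) 2 (stepMeasure ν) := by
  obtain ⟨K, hK⟩ := hg.exists_integral_walkSum_sq_le hν t
  exact memLp_two_of_tendsto (hg.memLp_walkSum hν t)
    (hν.tendsto_walk.mono fun x hx => hg.tendsto_walkSum t hx) hK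

theorem IsRenewalWeight.tendsto_integral_walkSum (hg : IsRenewalWeight g) (hν : IsStepLaw ν)
    (t : ℝ) : Tendsto (fun n => ∫ x, walkSum g t n x ∂stepMeasure ν) atTop
      (𝓝 (∫ x, walkTotal g t x ∂stepMeasure ν)) := by
  refine tendsto_integral_of_dominated_convergence (walkTotal g t)
    (fun n => (hg.measurable_walkSum t n).aestronglyMeasurable)
    ((hg.memLp_walkTotal hν t).integrable one_le_two) (fun n => ?_)
    (hν.tendsto_walk.mono fun x hx => hg.tendsto_walkSum t hx)
  filter_upwards [hν.tendsto_walk] with x hx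
  rw [Real.norm_of_nonneg (hg.walkSum_nonneg t n x)]
  exact hg.walkSum_le_walkTotal t n hx

theorem IsRenewalWeight.tendsto_integral_walkSum_sq (hg : IsRenewalWeight g) (hν : IsStepLaw ν)
    (t : ℝ) : Tendsto (fun n => ∫ x, walkSum g t n x ^ 2 ∂stepMeasure ν) atTop
      (𝓝 (∫ x, walkTotal g t x ^ 2 ∂stepMeasure ν)) := by
  refine tendsto_integral_of_dominated_convergence (fun x => walkTotal g t x ^ 2)
    (fun n => ((hg.measurable_walkSum t n).pow_const 2).aestronglyMeasurable)
    (hg.memLp_walkTotal hν t).integrable_sq (fun n => ?_)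
    (hν.tendsto_walk.mono fun x hx => (hg.tendsto_walkSum t hx).pow 2)
  filter_upwards [hν.tendsto_walk] with x hx
  rw [norm_pow, Real.norm_of_nonneg (hg.walkSum_nonneg t n x)]
  exact pow_le_pow_left₀ (hg.walkSum_nonneg t n x) (hg.walkSum_le_walkTotal t n hx) 2

theorem IsRenewalWeight.tendsto_variance_walkSum (hg : IsRenewalWeight g) (hν : IsStepLaw ν)
    (t : ℝ) : Tendsto (fun n => Var[walkSum g t n; stepMeasure ν]) atTop
      (𝓝 (Var[walkTotal g t; stepMeasure ν])) := by
  have := (hg.tendsto_integral_walkSum_sq hν t).sub ((hg.tendsto_integral_walkSum hν t).pow 2)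
  rw [variance_eq_sub (hg.memLp_walkTotal hν t)]
  refine this.congr fun n => ?_
  rw [variance_eq_sub (hg.memLp_walkSum hν t n)]
  rfl

end Bounds

/-! ### Stability of the variance -/

/-- The quadratic `c ↦ Var (X + c Y)` is nonnegative, so its discriminant is not positive. -/
theorem covariance_sq_le_variance_mul_variance {α : Type*} [MeasurableSpace α] {μ : Measure α}
    [IsFiniteMeasure μ] {X Y : α → ℝ} (hX : MemLp X 2 μ) (hY : MemLp Y 2 μ) :
    cov[X, Y; μ] ^ 2 ≤ Var[X; μ] * Var[Y; μ] := by
  have h : ∀ c : ℝ, 0 ≤ Var[Y; μ] * (c * c) + 2 * cov[X, Y; μ] * c + Var[X; μ] := fun c => by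
    have h1 := variance_nonneg (X + c • Y) μ
    rw [variance_add hX (hY.const_smul c), variance_smul, covariance_smul_right] at h1
    linarith
  have := discrim_le_zero h
  rw [discrim] at this
  linarith

/-- Perturbing a random variable by `X` changes its variance by little if `E X ^ 2` is small. -/
theorem abs_variance_sub_sub_variance_le {α : Type*} [MeasurableSpace α] {μ : Measure α}
    [IsProbabilityMeasure μ] {X Y : α → ℝ} (hX : MemLp X 2 μ) (hY : MemLp Y 2 μ) {b : ℝ}
    (hb : ∫ x, X x ^ 2 ∂μ ≤ b) :
    |Var[X - Y; μ] - Var[Y; μ]| ≤ 2 * √(Var[Y; μ] * b) + b := by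
  have h1 : Var[X; μ] ≤ b := (variance_le_expectation_sq hX.1).trans hb
  have h0 := variance_nonneg X μ
  have h3 : |cov[X, Y; μ]| ≤ √(Var[Y; μ] * b) := by
    refine Real.abs_le_sqrt ((covariance_sq_le_variance_mul_variance hX hY).trans ?_)
    rw [mul_comm]
    exact mul_le_mul_of_nonneg_left h1 (variance_nonneg Y μ)
  rw [variance_sub hX hY]
  have h4 := abs_le.1 h3
  rw [abs_le]
  constructor <;> linarith

/-! ### Renewal asymptotics for mean and variance -/

section Asymptotics

variable {ν : Measure ℝ} [IsProbabilityMeasure ν] {g : ℝ → ℝ}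

theorem IsRenewalWeight.walkTotal_nonneg (hg : IsRenewalWeight g) (t : ℝ) (x : ℕ → ℝ) :
    0 ≤ walkTotal g t x := tsum_nonneg fun _ => hg.nonneg _

theorem IsRenewalWeight.mul_integral_walkTotal_le (hg : IsRenewalWeight g) (hν : IsStepLaw ν)
    (t : ℝ) {A : ℝ} (hA : 0 ≤ A) :
    (∫ y, y ∂ν) * ∫ x, walkTotal g t x ∂stepMeasure ν ≤ (∫ u in (0 : ℝ)..t, g u) + A * g t +
      tailMoment ν 1 A * (g t + ∫ x, walkTotal g t x ∂stepMeasure ν) :=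
  le_of_tendsto_of_tendsto' ((hg.tendsto_integral_walkSum hν t).const_mul _)
    ((((hg.tendsto_integral_walkSum hν t).const_add _).const_mul _).const_add _)
    (fun n => hg.mul_integral_walkSum_le hν t n hA)

theorem eventually_integral_walk_eq (hg : IsRenewalWeight g) (t : ℝ) {x : ℕ → ℝ}
    (hx : Tendsto (walk x) atTop atTop) :
    ∀ᶠ n in atTop, ∫ u in (0 : ℝ)..walk x n, g (t - u) = ∫ u in (0 : ℝ)..t, g u :=
  (hx.eventually_ge_atTop t).mono fun _ hn => integral_comp_sub_eq_of_le hg.mono hg.neg hn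

theorem IsRenewalWeight.norm_integral_walk_le (hg : IsRenewalWeight g) (t : ℝ) {x : ℕ → ℝ}
    (hx : ∀ k, 0 < x k) (n : ℕ) :
    ‖∫ u in (0 : ℝ)..walk x n, g (t - u)‖ ≤ ∫ u in (0 : ℝ)..t, g u := by
  rw [Real.norm_of_nonneg (integral_comp_sub_nonneg hg.nonneg (walk_nonneg hx n))]
  exact integral_comp_sub_le hg.mono hg.nonneg hg.neg t _

theorem IsRenewalWeight.le_mul_integral_walkTotal (hg : IsRenewalWeight g) (hν : IsStepLaw ν)
    (t : ℝ) : (∫ u in (0 : ℝ)..t, g u) - (∫ y, y ∂ν) * g t ≤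
      (∫ y, y ∂ν) * ∫ x, walkTotal g t x ∂stepMeasure ν := by
  have h : Tendsto (fun n => ∫ x, (∫ u in (0 : ℝ)..walk x n, g (t - u)) ∂stepMeasure ν) atTop
      (𝓝 (∫ _, (∫ u in (0 : ℝ)..t, g u) ∂stepMeasure ν)) :=
    tendsto_integral_of_dominated_convergence (fun _ => ∫ u in (0 : ℝ)..t, g u)
      (fun n => (hg.measurable_integral_walk t n).aestronglyMeasurable) (integrable_const _)
      (fun n => hν.ae_pos.mono fun x hx => hg.norm_integral_walk_le t hx n)
      (hν.tendsto_walk.mono fun x hx =>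
        tendsto_nhds_of_eventually_eq (eventually_integral_walk_eq hg t hx))
  rw [integral_const, probReal_univ, one_smul] at h
  exact le_of_tendsto_of_tendsto' (h.sub_const _)
    ((hg.tendsto_integral_walkSum hν t).const_mul _) (fun n => hg.le_mul_integral_walkSum hν t n)

/-- Once the walk has passed `t`, the integral is complete and the last term is zero; before that
everything is bounded. -/
theorem IsRenewalWeight.tendsto_boundary_sq (hg : IsRenewalWeight g) (hν : IsStepLaw ν)
    (t : ℝ) : Tendsto (fun n => ∫ x, ((∫ u in (0 : ℝ)..walk x n, g (t - u)) -
      (∫ u in (0 : ℝ)..t, g u) + (∫ y, y ∂ν) * g (t - walk x n)) ^ 2 ∂stepMeasure ν) atTop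
      (𝓝 0) := by
  have h := tendsto_integral_of_dominated_convergence (μ := stepMeasure ν)
    (F := fun n x => ((∫ u in (0 : ℝ)..walk x n, g (t - u)) -
      (∫ u in (0 : ℝ)..t, g u) + (∫ y, y ∂ν) * g (t - walk x n)) ^ 2) (f := fun _ => 0)
    (fun _ => ((∫ u in (0 : ℝ)..t, g u) + ‖∫ u in (0 : ℝ)..t, g u‖ + ‖∫ y, y ∂ν‖ * g t) ^ 2)
    (fun n => ((((hg.measurable_integral_walk t n).sub_const _).add
      ((hg.measurable_comp_walk t n).const_mul _)).pow_const 2).aestronglyMeasurable)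
    (integrable_const _) (fun n => ?_) ?_
  · simpa using h
  · filter_upwards [hν.ae_pos] with x hx
    rw [norm_pow]
    refine pow_le_pow_left₀ (norm_nonneg _) ((norm_add_le _ _).trans (add_le_add
      ((norm_sub_le _ _).trans (add_le_add (hg.norm_integral_walk_le t hx n) le_rfl)) ?_)) 2
    rw [norm_mul, Real.norm_of_nonneg (hg.nonneg _)]
    exact mul_le_mul_of_nonneg_left (hg.comp_walk_le hx t n) (norm_nonneg _)
  · filter_upwards [hν.tendsto_walk] with x hx
    refine tendsto_nhds_of_eventually_eq ?_
    filter_upwards [eventually_integral_walk_eq hg t hx, hx.eventually_gt_atTop t] with n h1 h2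
    rw [h1, hg.neg _ (by linarith)]
    simp

theorem IsRenewalWeight.variance_walkMart (hg : IsRenewalWeight g) (hν : IsStepLaw ν)
    (t : ℝ) (n : ℕ) : Var[walkMart ν g t n; stepMeasure ν] =
      Var[id; ν] * ∑ k ∈ Finset.range n, ∫ x, g (t - walk x k) ^ 2 ∂stepMeasure ν := by
  rw [variance_of_integral_eq_zero (hg.measurable_walkMart t n).aemeasurable
    (hg.integral_walkMart hν t n), hg.integral_walkMart_sq hν]

theorem IsRenewalWeight.tendsto_variance_walkMart (hg : IsRenewalWeight g) (hν : IsStepLaw ν)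
    (t : ℝ) : Tendsto (fun n => Var[walkMart ν g t n; stepMeasure ν]) atTop
      (𝓝 (Var[id; ν] * (g t ^ 2 + ∫ x, walkTotal (fun t => g t ^ 2) t x ∂stepMeasure ν))) := by
  -- Shifting `n` by one splits off the `k = 0` term `g t ^ 2`.
  rw [← tendsto_add_atTop_iff_nat 1]
  refine (((hg.sq.tendsto_integral_walkSum hν t).const_add (g t ^ 2)).const_mul
    (Var[id; ν])).congr fun n => ?_
  rw [hg.variance_walkMart hν, Finset.sum_range_succ', add_comm (Finset.sum _ _)]
  simp only [walkSum]
  rw [integral_finsetSum _ fun k _ => hg.sq.integrable_comp_walk hν t (k + 1)]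
  simp

/-- `Q` is the limiting martingale variance and `b` the limiting bound on the second moment of the
rest. The comparison is made at finite `n`, so no limit of the martingale itself is needed. -/
theorem IsRenewalWeight.abs_variance_walkTotal_sub_le (hg : IsRenewalWeight g)
    (hν : IsStepLaw ν) (t : ℝ) {A b Q : ℝ} (hA : 0 ≤ A)
    (hb : b = 2 * (g t * (A ^ 2 * g t + tailMoment ν 2 A *
      (g t + ∫ x, walkTotal g t x ∂stepMeasure ν))))
    (hQ : Q = Var[id; ν] *
      (g t ^ 2 + ∫ x, walkTotal (fun t => g t ^ 2) t x ∂stepMeasure ν)) :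
    |(∫ y, y ∂ν) ^ 2 * Var[walkTotal g t; stepMeasure ν] - Q| ≤ 2 * √(Q * b) + b := by
  set G := ∫ u in (0 : ℝ)..t, g u with hG
  set m := ∫ y, y ∂ν with hm
  let δ : ℕ → (ℕ → ℝ) → ℝ := fun n x =>
    (∫ u in (0 : ℝ)..walk x n, g (t - u)) - G + m * g (t - walk x n)
  let bn : ℕ → ℝ := fun n => 2 * (g t * (A ^ 2 * g t + tailMoment ν 2 A *
    (g t + ∫ x, walkSum g t n x ∂stepMeasure ν))) + 2 * ∫ x, δ n x ^ 2 ∂stepMeasure ν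
  have hδ : ∀ n, MemLp (δ n) 2 (stepMeasure ν) := fun n =>
    ((hg.memLp_integral_walk hν t n 2).sub (memLp_const _)).add
      ((hg.memLp_comp_walk hν t n 2).const_mul _)
  have key : ∀ n, |m ^ 2 * Var[walkSum g t n; stepMeasure ν] -
      Var[walkMart ν g t n; stepMeasure ν]| ≤
      2 * √(Var[walkMart ν g t n; stepMeasure ν] * bn n) + bn n := fun n => by
    have hB : MemLp (walkErr g t n + δ n) 2 (stepMeasure ν) :=
      (hg.memLp_walkErr hν t n).add (hδ n)
    have hD := hg.memLp_walkMart hν t n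
    have e : Var[(walkErr g t n + δ n) - walkMart ν g t n; stepMeasure ν] =
        m ^ 2 * Var[walkSum g t n; stepMeasure ν] := by
      -- The shift `G - m * g t` is the deterministic part of the decomposition of `m * walkSum`.
      rw [← variance_const_mul, ← variance_add_const (hB.sub hD).1 (G - m * g t)]
      congr 1
      ext x
      simp only [hm, mul_walkSum_eq, Pi.add_apply, Pi.sub_apply, δ]
      ring
    rw [← e]
    refine abs_variance_sub_sub_variance_le hB hD ?_
    have i1 := (hg.memLp_walkErr hν t n).integrable_sq
    have i2 := (hδ n).integrable_sq
    calc ∫ x, (walkErr g t n + δ n) x ^ 2 ∂stepMeasure ν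
        ≤ ∫ x, (2 * walkErr g t n x ^ 2 + 2 * δ n x ^ 2) ∂stepMeasure ν := by
          refine integral_mono hB.integrable_sq ((i1.const_mul 2).add (i2.const_mul 2)) fun x => ?_
          simp only [Pi.add_apply]
          nlinarith [sq_nonneg (walkErr g t n x - δ n x)]
      _ = 2 * ∫ x, walkErr g t n x ^ 2 ∂stepMeasure ν + 2 * ∫ x, δ n x ^ 2 ∂stepMeasure ν := by
          rw [integral_add (i1.const_mul 2) (i2.const_mul 2), integral_const_mul,
            integral_const_mul]
      _ ≤ _ := by
          have := hg.integral_walkErr_sq_le hν t n hA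
          simp only [bn]
          linarith
  have hbn : Tendsto bn atTop (𝓝 b) := by
    have h1 := (((((hg.tendsto_integral_walkSum hν t).const_add (g t)).const_mul
      (tailMoment ν 2 A)).const_add (A ^ 2 * g t)).const_mul (g t)).const_mul 2
    have h2 := (hg.tendsto_boundary_sq hν t).const_mul 2
    have h3 := h1.add h2
    rw [mul_zero, add_zero, ← hb] at h3
    exact h3
  have hV := hg.tendsto_variance_walkMart hν t
  rw [← hQ] at hV
  exact le_of_tendsto_of_tendsto' (((hg.tendsto_variance_walkSum hν t).const_mul _).sub hV).abs
    (((hV.mul hbn).sqrt.const_mul 2).add hbn) key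

theorem tendsto_sqrt_div_self : Tendsto (fun t : ℝ => √t / t) atTop (𝓝 0) := by
  have := tendsto_inv_atTop_zero.comp Real.tendsto_sqrt_atTop
  refine this.congr fun t => ?_
  simp [Real.sqrt_div_self']

/-- With `A = √t` the truncation term `A * g t` is `o(t ^ (k + 1))`, while the tail moment still
tends to zero. -/
theorem IsRenewalWeight.tendsto_integral_walkTotal (hg : IsRenewalWeight g) (hν : IsStepLaw ν)
    {k : ℕ} {c : ℝ} (hc : Tendsto (fun t => g t / t ^ k) atTop (𝓝 c)) :
    Tendsto (fun t => (∫ x, walkTotal g t x ∂stepMeasure ν) / t ^ (k + 1)) atTop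
      (𝓝 (c / ((k + 1) * ∫ y, y ∂ν))) := by
  set m := ∫ y, y ∂ν with hm
  have hm0 : 0 < m := hν.integral_pos
  have hG := hg.mono.tendsto_integral_div_pow hg.nonneg hc
  have hl : Tendsto (fun t => tailMoment ν 1 √t) atTop (𝓝 0) :=
    (hν.tendsto_tailMoment one_le_two).comp Real.tendsto_sqrt_atTop
  have hinv : Tendsto (fun t : ℝ => t⁻¹) atTop (𝓝 0) := tendsto_inv_atTop_zero
  have lower : Tendsto (fun t => ((∫ u in (0 : ℝ)..t, g u) / t ^ (k + 1) -
      m * (g t / t ^ k * t⁻¹)) / m) atTop (𝓝 (c / ((k + 1) * m))) := by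
    have := (hG.sub ((hc.mul hinv).const_mul m)).div_const m
    convert this using 2
    field_simp
    ring
  have upper : Tendsto (fun t => ((∫ u in (0 : ℝ)..t, g u) / t ^ (k + 1) +
      √t / t * (g t / t ^ k) + tailMoment ν 1 √t * (g t / t ^ k * t⁻¹)) /
      (m - tailMoment ν 1 √t)) atTop (𝓝 (c / ((k + 1) * m))) := by
    have := ((hG.add (tendsto_sqrt_div_self.mul hc)).add (hl.mul (hc.mul hinv))).div
      (hl.const_sub m) (by simpa using hm0.ne')
    simp only [zero_mul, mul_zero, add_zero, sub_zero, div_div] at this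
    exact this
  refine tendsto_of_tendsto_of_tendsto_of_le_of_le' lower upper ?_ ?_
  · filter_upwards [eventually_gt_atTop 0] with t ht
    have := hg.le_mul_integral_walkTotal hν t
    rw [← hm] at this
    rw [div_le_div_iff₀ hm0 (by positivity)]
    calc _ = (∫ u in (0 : ℝ)..t, g u) - m * g t := by field_simp; ring
      _ ≤ _ := this
      _ = _ := mul_comm _ _
  · filter_upwards [eventually_gt_atTop 0, hl.eventually_lt_const hm0] with t ht hlt
    have := hg.mul_integral_walkTotal_le hν t (Real.sqrt_nonneg t)
    rw [← hm] at this
    rw [div_le_div_iff₀ (by positivity) (sub_pos.2 hlt)]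
    calc _ ≤ (∫ u in (0 : ℝ)..t, g u) + √t * g t + tailMoment ν 1 √t * g t := by linarith
      _ = _ := by field_simp; ring

theorem IsRenewalWeight.tendsto_variance_walkTotal (hg : IsRenewalWeight g) (hν : IsStepLaw ν)
    {k : ℕ} {c : ℝ} (hc : Tendsto (fun t => g t / t ^ k) atTop (𝓝 c)) :
    Tendsto (fun t => Var[walkTotal g t; stepMeasure ν] / t ^ (2 * k + 1)) atTop
      (𝓝 (Var[id; ν] * c ^ 2 / ((2 * k + 1) * (∫ y, y ∂ν) ^ 3))) := by
  set m := ∫ y, y ∂ν with hm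
  have hm0 : 0 < m := hν.integral_pos
  have hinv : Tendsto (fun t : ℝ => t⁻¹) atTop (𝓝 0) := tendsto_inv_atTop_zero
  have hc2 : Tendsto (fun t => g t ^ 2 / t ^ (2 * k)) atTop (𝓝 (c ^ 2)) :=
    (hc.pow 2).congr fun t => by rw [div_pow, ← pow_mul, mul_comm]
  have he := hg.tendsto_integral_walkTotal hν hc
  have he2 := hg.sq.tendsto_integral_walkTotal hν hc2
  -- The truncation level is `t^{1/4}`: its square `√t` is `o(t)`, and the tail moment still
  -- vanishes, so `b t = o(t ^ (2 * k + 1))`.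
  have hL : Tendsto (fun t => tailMoment ν 2 √√t) atTop (𝓝 0) :=
    (hν.tendsto_tailMoment le_rfl).comp
      (Real.tendsto_sqrt_atTop.comp Real.tendsto_sqrt_atTop)
  let b : ℝ → ℝ := fun t => 2 * (g t * (√√t ^ 2 * g t + tailMoment ν 2 √√t *
    (g t + ∫ x, walkTotal g t x ∂stepMeasure ν)))
  let Q : ℝ → ℝ := fun t => Var[id; ν] *
    (g t ^ 2 + ∫ x, walkTotal (fun t => g t ^ 2) t x ∂stepMeasure ν)
  have hb : Tendsto (fun t => b t / t ^ (2 * k + 1)) atTop (𝓝 0) := by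
    have := (hc.mul ((tendsto_sqrt_div_self.mul hc).add
      (hL.mul ((hc.mul hinv).add he)))).const_mul 2
    simp only [zero_mul, mul_zero, add_zero] at this
    refine this.congr' ?_
    filter_upwards [eventually_gt_atTop 0] with t ht
    simp only [b, Real.sq_sqrt (Real.sqrt_nonneg t)]
    field_simp
    ring
  have hQ : Tendsto (fun t => Q t / t ^ (2 * k + 1)) atTop
      (𝓝 (Var[id; ν] * (c ^ 2 / ((2 * k + 1) * m)))) := by
    have := ((hc2.mul hinv).add he2).const_mul (Var[id; ν])
    rw [mul_zero, zero_add] at this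
    push_cast at this
    refine this.congr' ?_
    filter_upwards [eventually_gt_atTop 0] with t ht
    simp only [Q]
    field_simp
    ring
  have hdiff : Tendsto (fun t => m ^ 2 * (Var[walkTotal g t; stepMeasure ν] / t ^ (2 * k + 1)) -
      Q t / t ^ (2 * k + 1)) atTop (𝓝 0) := by
    have hub := ((hQ.mul hb).sqrt.const_mul 2).add hb
    rw [mul_zero, Real.sqrt_zero, mul_zero, zero_add] at hub
    refine squeeze_zero_norm' ?_ hub
    filter_upwards [eventually_gt_atTop 0] with t ht
    have h := hg.abs_variance_walkTotal_sub_le hν t (Real.sqrt_nonneg (√t))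
      (b := b t) (Q := Q t) rfl rfl
    have hp : 0 < t ^ (2 * k + 1) := by positivity
    rw [Real.norm_eq_abs, mul_div_assoc', ← sub_div, abs_div, abs_of_pos hp,
      div_mul_div_comm, Real.sqrt_div' _ (by positivity), Real.sqrt_mul_self hp.le,
      mul_div_assoc', ← add_div]
    exact div_le_div_of_nonneg_right h hp.le
  have := (hdiff.add hQ).div_const (m ^ 2)
  convert this using 2
  · field_simp
    ring
  · field_simp
    ring

end Asymptotics

/-! ### Independence of disjoint coordinate families -/

theorem comap_reindex_le {ι γ 𝓧 : Type*} [MeasurableSpace 𝓧] (f : γ → ι) :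
    MeasurableSpace.comap (fun (y : ι → 𝓧) a => y (f a)) MeasurableSpace.pi ≤
      ⨆ i ∈ Set.range f, MeasurableSpace.comap (fun y : ι → 𝓧 => y i) inferInstance := by
  rw [← measurable_iff_comap_le]
  refine @measurable_pi_lambda _ _ _ (_) _ _ fun a => ?_
  exact (comap_measurable _).mono
    (le_iSup₂_of_le (f a) (Set.mem_range_self a) le_rfl) le_rfl

theorem indepFun_reindex_infinitePi {ι α β 𝓧 : Type*} [MeasurableSpace 𝓧] {μ : Measure 𝓧}
    [IsProbabilityMeasure μ] {e : α → ι} {e' : β → ι}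
    (h : Disjoint (Set.range e) (Set.range e')) :
    IndepFun (fun (y : ι → 𝓧) a => y (e a)) (fun y b => y (e' b))
      (Measure.infinitePi fun _ : ι => μ) := by
  have hi : iIndepFun (fun (i : ι) (y : ι → 𝓧) => y i) (Measure.infinitePi fun _ : ι => μ) :=
    iIndepFun_infinitePi (X := fun _ y => y) (fun _ => measurable_id)
  have hle : ∀ i : ι, MeasurableSpace.comap (fun y : ι → 𝓧 => y i) inferInstance ≤
    MeasurableSpace.pi := fun i => (measurable_pi_apply i).comap_le
  rw [IndepFun_iff_Indep]
  exact indep_of_indep_of_le_left (indep_of_indep_of_le_right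
    (indep_iSup_of_disjoint hle hi.iIndep h) (comap_reindex_le e')) (comap_reindex_le e)

/-! ### First-generation decomposition and moment recursions -/

section Tree

variable {ν : Measure ℝ} [IsProbabilityMeasure ν]

/-- The law of a family of independent walks indexed by the individuals. -/
noncomputable abbrev treeMeasure (ν : Measure ℝ) [IsProbabilityMeasure ν] :
    Measure (List ℕ → ℕ → ℝ) :=
  Measure.infinitePi fun _ => stepMeasure ν

/-- The subtree of descendants of the child number `i` of the ancestor. -/
def subtree (i : ℕ) (y : List ℕ → ℕ → ℝ) : List ℕ → ℕ → ℝ := fun u => y (u ++ [i])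

/-- The number of individuals of generation `j` born up to time `t`, by first-generation
decomposition. -/
noncomputable def treeCount : ℕ → ℝ → (List ℕ → ℕ → ℝ) → ENNReal
  | 0, t, _ => Set.indicator (Set.Ici 0) 1 t
  | j + 1, t, y => ∑' i, treeCount j (t - walk (y []) (i + 1)) (subtree i y)

theorem treeCount_mono (j : ℕ) (y : List ℕ → ℕ → ℝ) : Monotone fun t => treeCount j t y := by
  induction j generalizing y with
  | zero =>
    intro s t h
    by_cases hs : 0 ≤ s
    · simp [treeCount, hs, hs.trans h]
    · simp [treeCount, hs]
  | succ j ih => exact fun s t h => ENNReal.tsum_le_tsum fun i => ih _ (by simpa using h)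

@[fun_prop]
theorem measurable_subtree (i : ℕ) : Measurable (subtree i) :=
  measurable_pi_lambda _ fun _ => measurable_pi_apply _

theorem measurable_treeCount_prod (j : ℕ) :
    Measurable fun p : (List ℕ → ℕ → ℝ) × ℝ => treeCount j p.2 p.1 := by
  induction j with
  | zero => exact (measurable_one.indicator measurableSet_Ici).comp measurable_snd
  | succ j ih =>
    refine Measurable.tsum fun i => ih.comp (f := fun p : (List ℕ → ℕ → ℝ) × ℝ =>
      (subtree i p.1, p.2 - walk (p.1 []) (i + 1))) ?_
    refine ((measurable_subtree i).comp measurable_fst).prodMk (measurable_snd.sub ?_)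
    exact (measurable_walk _).comp ((measurable_pi_apply _).comp measurable_fst)

theorem measurable_treeCount (j : ℕ) (t : ℝ) : Measurable (treeCount j t) :=
  (measurable_treeCount_prod j).comp measurable_prodMk_right

/-- The most recent child number is at the head of a label, so descendants of the ancestor's child
`i` are the lists ending in `i`. Reindexing along an injection preserves the product law. -/
theorem map_subtree (i : ℕ) : (treeMeasure ν).map (subtree i) = treeMeasure ν :=
  Measure.map_infinitePi_infinitePi_of_inj (P := fun _ : List ℕ => stepMeasure ν)
    (f := fun u => u ++ [i]) (fun _ _ h => List.append_cancel_right h)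

/-- Conditioning as Fubini: the subtree is replaced by a fresh tree while `h` is frozen. -/
theorem lintegral_subtree_of_indepFun {γ : Type*} [MeasurableSpace γ] (i : ℕ)
    {h : (List ℕ → ℕ → ℝ) → γ} (hm : Measurable h)
    (hi : IndepFun (subtree i) h (treeMeasure ν)) {F : (List ℕ → ℕ → ℝ) × γ → ENNReal}
    (hF : Measurable F) :
    ∫⁻ y, F (subtree i y, h y) ∂treeMeasure ν =
      ∫⁻ y, ∫⁻ z, F (z, h y) ∂treeMeasure ν ∂treeMeasure ν := by
  have := Measure.isProbabilityMeasure_map (μ := treeMeasure ν) hm.aemeasurable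
  have e := hi.map_prod_eq_prod_map_map (measurable_subtree i).aemeasurable hm.aemeasurable
  rw [map_subtree] at e
  rw [← lintegral_map (f := F) hF ((measurable_subtree i).prodMk hm), e,
    lintegral_prod_symm' _ hF, lintegral_map hF.lintegral_prod_left' hm]

theorem indepFun_subtree_root (i : ℕ) :
    IndepFun (subtree i) (fun y => y []) (treeMeasure ν) := by
  have := indepFun_reindex_infinitePi (μ := stepMeasure ν) (e := fun u : List ℕ => u ++ [i])
    (e' := fun _ : Unit => ([] : List ℕ)) (by
      rw [Set.disjoint_left]
      rintro _ ⟨u, rfl⟩ ⟨_, h⟩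
      simp at h)
  exact this.comp measurable_id (measurable_pi_apply ())

theorem indepFun_subtree_subtree_root {i k : ℕ} (hik : i ≠ k) :
    IndepFun (subtree i) (fun y => (subtree k y, y [])) (treeMeasure ν) := by
  have := indepFun_reindex_infinitePi (μ := stepMeasure ν) (e := fun u : List ℕ => u ++ [i])
    -- `none` indexes the ancestor, and `some u` the individuals below child `k`.
    (e' := fun o : Option (List ℕ) => o.elim [] fun u => u ++ [k]) (by
      rw [Set.disjoint_left]
      rintro _ ⟨u, rfl⟩ ⟨o, h⟩
      cases o with
      | none => simp at h
      | some w =>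
        simp only [Option.elim_some] at h
        exact hik (by simpa using (List.append_inj' h rfl).2.symm))
  have hψ : Measurable fun z : Option (List ℕ) → ℕ → ℝ =>
      ((fun u => z (some u) : List ℕ → ℕ → ℝ), z none) := by fun_prop
  exact this.comp measurable_id hψ

theorem lintegral_root {F : (ℕ → ℝ) → ENNReal} (hF : Measurable F) :
    ∫⁻ y, F (y []) ∂treeMeasure ν = ∫⁻ x, F x ∂stepMeasure ν :=
  (measurePreserving_eval_infinitePi (fun _ : List ℕ => stepMeasure ν) []).lintegral_comp hF

/-- The mean of `treeCount j t`. -/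
noncomputable def treeMean (ν : Measure ℝ) [IsProbabilityMeasure ν] (j : ℕ) (t : ℝ) : ENNReal :=
  ∫⁻ y, treeCount j t y ∂treeMeasure ν

/-- The second moment of `treeCount j t`. -/
noncomputable def treeSecondMoment (ν : Measure ℝ) [IsProbabilityMeasure ν] (j : ℕ) (t : ℝ) :
    ENNReal :=
  ∫⁻ y, treeCount j t y ^ 2 ∂treeMeasure ν

theorem treeMean_mono (j : ℕ) : Monotone (treeMean ν j) :=
  fun _ _ h => lintegral_mono fun y => treeCount_mono j y h

theorem treeSecondMoment_mono (j : ℕ) : Monotone (treeSecondMoment ν j) :=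
  fun _ _ h => lintegral_mono fun y => pow_le_pow_left' (treeCount_mono j y h) 2

theorem measurable_shifted_treeCount (j : ℕ) (t : ℝ) (i : ℕ) :
    Measurable fun p : (List ℕ → ℕ → ℝ) × (ℕ → ℝ) => treeCount j (t - walk p.2 (i + 1)) p.1 :=
  (measurable_treeCount_prod j).comp (measurable_fst.prodMk
    (measurable_const.sub ((measurable_walk _).comp measurable_snd)))

theorem measurable_subtree_treeCount (j : ℕ) (t : ℝ) (i : ℕ) :
    Measurable fun y => treeCount j (t - walk (y []) (i + 1)) (subtree i y) :=
  (measurable_shifted_treeCount j t i).comp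
    ((measurable_subtree i).prodMk (measurable_pi_apply _))

theorem Monotone.measurable_comp_walk {f : ℝ → ENNReal} (hf : Monotone f) (t : ℝ) (k : ℕ) :
    Measurable fun x => f (t - walk x k) :=
  hf.measurable.comp (measurable_const.sub (measurable_walk k))

theorem treeMean_succ (j : ℕ) (t : ℝ) :
    treeMean ν (j + 1) t =
      ∫⁻ x, ∑' i, treeMean ν j (t - walk x (i + 1)) ∂stepMeasure ν := by
  have hb := fun i => (treeMean_mono (ν := ν) j).measurable_comp_walk t (i + 1)
  rw [treeMean]
  simp only [treeCount]
  rw [lintegral_tsum fun i => (measurable_subtree_treeCount j t i).aemeasurable,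
    lintegral_tsum fun i => (hb i).aemeasurable]
  refine tsum_congr fun i => ?_
  rw [lintegral_subtree_of_indepFun i (measurable_pi_apply []) (indepFun_subtree_root i)
    (measurable_shifted_treeCount j t i)]
  exact lintegral_root (hb i)

theorem lintegral_subtree_sq (j : ℕ) (t : ℝ) (i : ℕ) :
    ∫⁻ y, treeCount j (t - walk (y []) (i + 1)) (subtree i y) ^ 2 ∂treeMeasure ν =
      ∫⁻ x, treeSecondMoment ν j (t - walk x (i + 1)) ∂stepMeasure ν := by
  rw [lintegral_subtree_of_indepFun i (measurable_pi_apply []) (indepFun_subtree_root i)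
    ((measurable_shifted_treeCount j t i).pow_const 2)]
  exact lintegral_root ((treeSecondMoment_mono (ν := ν) j).measurable_comp_walk t (i + 1))

/-- Integrate out subtree `i` with subtree `k` and the root frozen, then subtree `k` given the root.
-/
theorem lintegral_subtree_mul {i k : ℕ} (hik : i ≠ k) (j : ℕ) (t : ℝ) :
    ∫⁻ y, treeCount j (t - walk (y []) (i + 1)) (subtree i y) *
        treeCount j (t - walk (y []) (k + 1)) (subtree k y) ∂treeMeasure ν =
      ∫⁻ x, treeMean ν j (t - walk x (i + 1)) * treeMean ν j (t - walk x (k + 1))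
        ∂stepMeasure ν := by
  have hb := fun i => (treeMean_mono (ν := ν) j).measurable_comp_walk t (i + 1)
  have hF : Measurable fun p : (List ℕ → ℕ → ℝ) × ((List ℕ → ℕ → ℝ) × (ℕ → ℝ)) =>
      treeCount j (t - walk p.2.2 (i + 1)) p.1 * treeCount j (t - walk p.2.2 (k + 1)) p.2.1 :=
    ((measurable_shifted_treeCount j t i).comp
      (measurable_fst.prodMk (measurable_snd.comp measurable_snd))).mul
      ((measurable_shifted_treeCount j t k).comp measurable_snd)
  rw [lintegral_subtree_of_indepFun i ((measurable_subtree k).prodMk (measurable_pi_apply []))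
    (indepFun_subtree_subtree_root hik) hF]
  have e : ∀ y : List ℕ → ℕ → ℝ, ∫⁻ z, treeCount j (t - walk (y []) (i + 1)) z *
      treeCount j (t - walk (y []) (k + 1)) (subtree k y) ∂treeMeasure ν =
      treeMean ν j (t - walk (y []) (i + 1)) *
        treeCount j (t - walk (y []) (k + 1)) (subtree k y) := fun y =>
    lintegral_mul_const _ (measurable_treeCount j _)
  simp_rw [e]
  have hG : Measurable fun p : (List ℕ → ℕ → ℝ) × (ℕ → ℝ) =>
      treeMean ν j (t - walk p.2 (i + 1)) * treeCount j (t - walk p.2 (k + 1)) p.1 :=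
    ((hb i).comp measurable_snd).mul (measurable_shifted_treeCount j t k)
  rw [lintegral_subtree_of_indepFun k (measurable_pi_apply []) (indepFun_subtree_root k) hG]
  have e' : ∀ y : List ℕ → ℕ → ℝ, ∫⁻ z, treeMean ν j (t - walk (y []) (i + 1)) *
      treeCount j (t - walk (y []) (k + 1)) z ∂treeMeasure ν =
      treeMean ν j (t - walk (y []) (i + 1)) * treeMean ν j (t - walk (y []) (k + 1)) := fun y =>
    lintegral_const_mul _ (measurable_treeCount j _)
  simp_rw [e']
  exact lintegral_root ((hb i).mul (hb k))

theorem lintegral_tsum_sq {α : Type*} [MeasurableSpace α] {μ : Measure α} {a : ℕ → α → ENNReal}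
    (ha : ∀ i, Measurable (a i)) :
    ∫⁻ x, (∑' i, a i x) ^ 2 ∂μ = ∑' i, ∑' k, ∫⁻ x, a i x * a k x ∂μ := by
  simp_rw [sq, ← ENNReal.tsum_mul_right, ← ENNReal.tsum_mul_left]
  rw [lintegral_tsum fun i =>
    (Measurable.tsum (f := fun k x => a i x * a k x) fun k => (ha i).mul (ha k)).aemeasurable]
  exact tsum_congr fun i => lintegral_tsum fun k => ((ha i).mul (ha k)).aemeasurable

/-- Off-diagonal terms of the squared sum factor into means, and diagonal ones give second moments.
The squared means are added on the left because subtraction in `ENNReal` is truncated. -/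
theorem treeSecondMoment_succ (j : ℕ) (t : ℝ) :
    treeSecondMoment ν (j + 1) t +
        ∫⁻ x, ∑' i, treeMean ν j (t - walk x (i + 1)) ^ 2 ∂stepMeasure ν =
      ∫⁻ x, (∑' i, treeMean ν j (t - walk x (i + 1))) ^ 2 ∂stepMeasure ν +
        ∫⁻ x, ∑' i, treeSecondMoment ν j (t - walk x (i + 1)) ∂stepMeasure ν := by
  have hb := fun i => (treeMean_mono (ν := ν) j).measurable_comp_walk t (i + 1)
  have hw := fun i => (treeSecondMoment_mono (ν := ν) j).measurable_comp_walk t (i + 1)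
  rw [treeSecondMoment]
  simp only [treeCount]
  rw [lintegral_tsum_sq (measurable_subtree_treeCount j t), lintegral_tsum_sq hb,
    lintegral_tsum fun i => ((hb i).pow_const 2).aemeasurable,
    lintegral_tsum fun i => (hw i).aemeasurable, ← ENNReal.tsum_add, ← ENNReal.tsum_add]
  refine tsum_congr fun i => ?_
  -- The diagonal terms become sums over `k` supported at `k = i`, so the identity can be checked
  -- termwise.
  rw [← tsum_ite_eq i (fun _ => ∫⁻ x, treeMean ν j (t - walk x (i + 1)) ^ 2 ∂stepMeasure ν),
    ← tsum_ite_eq i (fun _ => ∫⁻ x, treeSecondMoment ν j (t - walk x (i + 1)) ∂stepMeasure ν),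
    ← ENNReal.tsum_add, ← ENNReal.tsum_add]
  refine tsum_congr fun k => ?_
  by_cases hik : k = i
  · subst hik
    simp only [if_true, ← sq]
    rw [lintegral_subtree_sq, add_comm]
  · simp only [hik, if_false, add_zero]
    exact lintegral_subtree_mul (Ne.symm hik) j t

end Tree

/-! ### Finiteness and growth of generation moments -/

section TreeMoments

variable {ν : Measure ℝ} [IsProbabilityMeasure ν]

theorem IsRenewalWeight.ofReal_walkTotal {g : ℝ → ℝ} (hg : IsRenewalWeight g) (t : ℝ) {x : ℕ → ℝ}
    (hx : Tendsto (walk x) atTop atTop) :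
    ENNReal.ofReal (walkTotal g t x) = ∑' i, ENNReal.ofReal (g (t - walk x (i + 1))) :=
  ENNReal.ofReal_tsum_of_nonneg (fun _ => hg.nonneg _) (hg.summable_walk t hx)

theorem IsRenewalWeight.lintegral_tsum_walk {g : ℝ → ℝ} (hg : IsRenewalWeight g)
    (hν : IsStepLaw ν) (t : ℝ) :
    ∫⁻ x, ∑' i, ENNReal.ofReal (g (t - walk x (i + 1))) ∂stepMeasure ν =
      ENNReal.ofReal (∫ x, walkTotal g t x ∂stepMeasure ν) := by
  rw [ofReal_integral_eq_lintegral_ofReal ((hg.memLp_walkTotal hν t).integrable one_le_two)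
    (Eventually.of_forall fun x => hg.walkTotal_nonneg t x)]
  exact lintegral_congr_ae (hν.tendsto_walk.mono fun x hx => (hg.ofReal_walkTotal t hx).symm)

theorem IsRenewalWeight.lintegral_tsum_walk_sq {g : ℝ → ℝ} (hg : IsRenewalWeight g)
    (hν : IsStepLaw ν) (t : ℝ) :
    ∫⁻ x, (∑' i, ENNReal.ofReal (g (t - walk x (i + 1)))) ^ 2 ∂stepMeasure ν =
      ENNReal.ofReal (∫ x, walkTotal g t x ^ 2 ∂stepMeasure ν) := by
  rw [ofReal_integral_eq_lintegral_ofReal (hg.memLp_walkTotal hν t).integrable_sq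
    (Eventually.of_forall fun x => sq_nonneg _)]
  refine lintegral_congr_ae (hν.tendsto_walk.mono fun x hx => ?_)
  simp only
  rw [ENNReal.ofReal_pow (hg.walkTotal_nonneg t x), hg.ofReal_walkTotal t hx]

theorem IsRenewalWeight.walkTotal_eq_zero {g : ℝ → ℝ} (hg : IsRenewalWeight g) {t : ℝ}
    (ht : t < 0) {x : ℕ → ℝ} (hx : ∀ k, 0 < x k) : walkTotal g t x = 0 := by
  have : ∀ k, g (t - walk x (k + 1)) = 0 := fun k =>
    hg.neg _ (by linarith [walk_nonneg hx (k + 1)])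
  simp [walkTotal, this]

theorem IsRenewalWeight.integral_walkTotal_eq_zero {g : ℝ → ℝ} (hg : IsRenewalWeight g)
    (hν : IsStepLaw ν) {t : ℝ} (ht : t < 0) : ∫ x, walkTotal g t x ∂stepMeasure ν = 0 :=
  integral_eq_zero_of_ae (hν.ae_pos.mono fun _ hx => hg.walkTotal_eq_zero ht hx)

theorem IsRenewalWeight.integral_walkTotal_sq_eq_zero {g : ℝ → ℝ} (hg : IsRenewalWeight g)
    (hν : IsStepLaw ν) {t : ℝ} (ht : t < 0) : ∫ x, walkTotal g t x ^ 2 ∂stepMeasure ν = 0 :=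
  integral_eq_zero_of_ae (hν.ae_pos.mono fun _ hx => by simp [hg.walkTotal_eq_zero ht hx])

/-- `f` is the `ENNReal`-valued version of a renewal weight. -/
structure IsFiniteWeight (f : ℝ → ENNReal) : Prop where
  ne_top : ∀ t, f t ≠ ⊤
  weight : IsRenewalWeight fun t => (f t).toReal

theorem isFiniteWeight_of_mono {f : ℝ → ENNReal} (hf : Monotone f) (ht : ∀ t, f t ≠ ⊤)
    (hneg : ∀ t < 0, f t = 0) : IsFiniteWeight f where
  ne_top := ht
  weight :=
    { mono := fun _ t h => ENNReal.toReal_mono (ht t) (hf h)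
      nonneg := fun _ => ENNReal.toReal_nonneg
      neg := fun t h => by simp [hneg t h] }

theorem treeMean_zero (t : ℝ) : treeMean ν 0 t = Set.indicator (Set.Ici 0) 1 t := by
  simp [treeMean, treeCount]

theorem treeSecondMoment_zero (t : ℝ) :
    treeSecondMoment ν 0 t = Set.indicator (Set.Ici 0) 1 t := by
  by_cases h : 0 ≤ t <;> simp [treeSecondMoment, treeCount, h]

theorem treeMean_succ_eq_ofReal (hν : IsStepLaw ν) {j : ℕ}
    (hv : IsFiniteWeight (treeMean ν j)) (t : ℝ) :
    treeMean ν (j + 1) t = ENNReal.ofReal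
      (∫ x, walkTotal (fun t => (treeMean ν j t).toReal) t x ∂stepMeasure ν) := by
  rw [treeMean_succ, ← hv.weight.lintegral_tsum_walk hν]
  simp only [ENNReal.ofReal_toReal (hv.ne_top _)]

theorem treeSecondMoment_succ_add_ofReal (hν : IsStepLaw ν) {j : ℕ}
    (hv : IsFiniteWeight (treeMean ν j)) (hw : IsFiniteWeight (treeSecondMoment ν j)) (t : ℝ) :
    treeSecondMoment ν (j + 1) t + ENNReal.ofReal
      (∫ x, walkTotal (fun t => (treeMean ν j t).toReal ^ 2) t x ∂stepMeasure ν) =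
      ENNReal.ofReal (∫ x, walkTotal (fun t => (treeMean ν j t).toReal) t x ^ 2 ∂stepMeasure ν) +
      ENNReal.ofReal
        (∫ x, walkTotal (fun t => (treeSecondMoment ν j t).toReal) t x ∂stepMeasure ν) := by
  rw [← hv.weight.lintegral_tsum_walk_sq hν, ← hw.weight.lintegral_tsum_walk hν,
    ← hv.weight.sq.lintegral_tsum_walk hν]
  simp only [ENNReal.ofReal_toReal (hv.ne_top _), ENNReal.ofReal_toReal (hw.ne_top _),
    ENNReal.ofReal_pow ENNReal.toReal_nonneg]
  exact treeSecondMoment_succ j t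

/-- Both moments go through one induction: once they are finite weights in generation `j`, the
square integrability of `walkTotal` makes the recursions finite in generation `j + 1`. -/
theorem isFiniteWeight_treeMoments (hν : IsStepLaw ν) (j : ℕ) :
    IsFiniteWeight (treeMean ν j) ∧ IsFiniteWeight (treeSecondMoment ν j) := by
  induction j with
  | zero =>
    constructor
    · refine isFiniteWeight_of_mono (treeMean_mono 0) (fun t => ?_) fun t ht => ?_ <;>
      rw [treeMean_zero]
      · by_cases h : 0 ≤ t <;> simp [h]
      · simp [ht]
    · refine isFiniteWeight_of_mono (treeSecondMoment_mono 0) (fun t => ?_) fun t ht => ?_ <;>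
      rw [treeSecondMoment_zero]
      · by_cases h : 0 ≤ t <;> simp [h]
      · simp [ht]
  | succ j ih =>
    obtain ⟨hv, hw⟩ := ih
    have h1 := treeMean_succ_eq_ofReal hν hv
    have h2 := treeSecondMoment_succ_add_ofReal hν hv hw
    constructor
    · refine isFiniteWeight_of_mono (treeMean_mono _) (fun t => ?_) fun t ht => ?_ <;> rw [h1]
      · exact ENNReal.ofReal_ne_top
      · rw [hv.weight.integral_walkTotal_eq_zero hν ht, ENNReal.ofReal_zero]
    · refine isFiniteWeight_of_mono (treeSecondMoment_mono _) (fun t => ?_) fun t ht => ?_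
      · refine ne_top_of_le_ne_top ?_ (le_self_add.trans (h2 t).le)
        exact ENNReal.add_ne_top.2 ⟨ENNReal.ofReal_ne_top, ENNReal.ofReal_ne_top⟩
      · have := h2 t
        rw [hv.weight.integral_walkTotal_sq_eq_zero hν ht,
          hw.weight.integral_walkTotal_eq_zero hν ht] at this
        simp only [ENNReal.ofReal_zero, add_zero] at this
        exact le_antisymm (le_self_add.trans this.le) zero_le

theorem toReal_treeMean_succ (hν : IsStepLaw ν) (j : ℕ) (t : ℝ) :
    (treeMean ν (j + 1) t).toReal =
      ∫ x, walkTotal (fun t => (treeMean ν j t).toReal) t x ∂stepMeasure ν := by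
  have hv := (isFiniteWeight_treeMoments hν j).1
  rw [treeMean_succ_eq_ofReal hν hv,
    ENNReal.toReal_ofReal (integral_nonneg fun x => hv.weight.walkTotal_nonneg t x)]

theorem toReal_treeSecondMoment_succ (hν : IsStepLaw ν) (j : ℕ) (t : ℝ) :
    (treeSecondMoment ν (j + 1) t).toReal +
      ∫ x, walkTotal (fun t => (treeMean ν j t).toReal ^ 2) t x ∂stepMeasure ν =
      ∫ x, walkTotal (fun t => (treeMean ν j t).toReal) t x ^ 2 ∂stepMeasure ν +
      ∫ x, walkTotal (fun t => (treeSecondMoment ν j t).toReal) t x ∂stepMeasure ν := by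
  obtain ⟨hv, hw⟩ := isFiniteWeight_treeMoments hν j
  have h := congrArg ENNReal.toReal (treeSecondMoment_succ_add_ofReal hν hv hw t)
  rwa [ENNReal.toReal_add ((isFiniteWeight_treeMoments hν (j + 1)).2.ne_top t)
    ENNReal.ofReal_ne_top, ENNReal.toReal_add ENNReal.ofReal_ne_top ENNReal.ofReal_ne_top,
    ENNReal.toReal_ofReal (integral_nonneg fun x => hv.weight.sq.walkTotal_nonneg t x),
    ENNReal.toReal_ofReal (integral_nonneg fun x => hw.weight.walkTotal_nonneg t x),
    ENNReal.toReal_ofReal (integral_nonneg fun x => sq_nonneg _)] at h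

/-- The variance of `treeCount j t`. -/
noncomputable def treeVariance (ν : Measure ℝ) [IsProbabilityMeasure ν] (j : ℕ) (t : ℝ) : ℝ :=
  (treeSecondMoment ν j t).toReal - (treeMean ν j t).toReal ^ 2

/-- Law of total variance given the ancestor's walk; the bracket is the mean conditional variance.
-/
theorem treeVariance_succ (hν : IsStepLaw ν) (j : ℕ) (t : ℝ) :
    treeVariance ν (j + 1) t =
      Var[walkTotal (fun t => (treeMean ν j t).toReal) t; stepMeasure ν] +
      (∫ x, walkTotal (fun t => (treeSecondMoment ν j t).toReal) t x ∂stepMeasure ν -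
        ∫ x, walkTotal (fun t => (treeMean ν j t).toReal ^ 2) t x ∂stepMeasure ν) := by
  have h := toReal_treeSecondMoment_succ hν j t
  rw [variance_eq_sub ((isFiniteWeight_treeMoments hν j).1.weight.memLp_walkTotal hν t),
    treeVariance, toReal_treeMean_succ hν]
  simp only [Pi.pow_apply]
  linarith

theorem tendsto_treeMean (hν : IsStepLaw ν) (j : ℕ) :
    Tendsto (fun t => (treeMean ν j t).toReal / t ^ j) atTop
      (𝓝 (1 / (j.factorial * (∫ y, y ∂ν) ^ j))) := by
  induction j with
  | zero =>
    refine tendsto_nhds_of_eventually_eq ?_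
    filter_upwards [eventually_ge_atTop 0] with t ht
    simp [treeMean_zero, ht]
  | succ j ih =>
    have := (isFiniteWeight_treeMoments hν j).1.weight.tendsto_integral_walkTotal hν ih
    simp_rw [toReal_treeMean_succ hν]
    convert this using 2
    rw [Nat.factorial_succ, div_div]
    push_cast
    ring

/-- Under `hw` the two sums in the mean conditional variance have the same leading term, which
cancels. -/
theorem tendsto_treeVariance_succ (hν : IsStepLaw ν) {j : ℕ}
    (hw : Tendsto (fun t => (treeSecondMoment ν j t).toReal / t ^ (2 * j)) atTop
      (𝓝 ((1 / (j.factorial * (∫ y, y ∂ν) ^ j)) ^ 2))) :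
    Tendsto (fun t => treeVariance ν (j + 1) t / t ^ (2 * j + 1)) atTop
      (𝓝 (Var[id; ν] * (1 / (j.factorial * (∫ y, y ∂ν) ^ j)) ^ 2 /
        ((2 * j + 1) * (∫ y, y ∂ν) ^ 3))) := by
  obtain ⟨hv', hw'⟩ := isFiniteWeight_treeMoments hν j
  have hc := tendsto_treeMean hν j
  have hc2 := (hc.pow 2).congr fun t => show _ = (treeMean ν j t).toReal ^ 2 / t ^ (2 * j) by
    rw [div_pow, ← pow_mul, mul_comm]
  have h := (hv'.weight.tendsto_variance_walkTotal hν hc).add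
    ((hw'.weight.tendsto_integral_walkTotal hν hw).sub
      (hv'.weight.sq.tendsto_integral_walkTotal hν hc2))
  rw [sub_self, add_zero] at h
  refine h.congr fun t => ?_
  rw [treeVariance_succ hν]
  ring

/-- The variance has order one power of `t` below the squared mean, so the latter alone determines
the limit. -/
theorem tendsto_treeSecondMoment (hν : IsStepLaw ν) (j : ℕ) :
    Tendsto (fun t => (treeSecondMoment ν j t).toReal / t ^ (2 * j)) atTop
      (𝓝 ((1 / (j.factorial * (∫ y, y ∂ν) ^ j)) ^ 2)) := by
  induction j with
  | zero =>
    refine tendsto_nhds_of_eventually_eq ?_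
    filter_upwards [eventually_ge_atTop 0] with t ht
    simp [treeSecondMoment_zero, ht]
  | succ j ih =>
    have h := ((tendsto_treeVariance_succ hν ih).mul tendsto_inv_atTop_zero).add
      ((tendsto_treeMean hν (j + 1)).pow 2)
    rw [mul_zero, zero_add] at h
    refine h.congr' ?_
    filter_upwards [eventually_gt_atTop 0] with t ht
    rw [treeVariance]
    field_simp
    ring

theorem memLp_toReal_treeCount (hν : IsStepLaw ν) (j : ℕ) (t : ℝ) :
    MemLp (fun y => (treeCount j t y).toReal) 2 (treeMeasure ν) := by
  rw [memLp_two_iff_integrable_sq (measurable_treeCount j t).ennreal_toReal.aestronglyMeasurable]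
  simp_rw [← ENNReal.toReal_pow]
  exact integrable_toReal_of_lintegral_ne_top ((measurable_treeCount j t).pow_const 2).aemeasurable
    ((isFiniteWeight_treeMoments hν j).2.ne_top t)

theorem ae_treeCount_ne_top (hν : IsStepLaw ν) (j : ℕ) (t : ℝ) :
    ∀ᵐ y ∂treeMeasure ν, treeCount j t y ≠ ⊤ :=
  (ae_lt_top (measurable_treeCount j t) ((isFiniteWeight_treeMoments hν j).1.ne_top t)).mono
    fun _ h => h.ne

theorem variance_toReal_treeCount (hν : IsStepLaw ν) (j : ℕ) (t : ℝ) :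
    Var[fun y => (treeCount j t y).toReal; treeMeasure ν] = treeVariance ν j t := by
  rw [variance_eq_sub (memLp_toReal_treeCount hν j t), treeVariance, treeMean, treeSecondMoment,
    integral_toReal (measurable_treeCount j t).aemeasurable
      ((ae_treeCount_ne_top hν j t).mono fun _ h => h.lt_top),
    ← integral_toReal ((measurable_treeCount j t).pow_const 2).aemeasurable
      ((ae_treeCount_ne_top hν j t).mono fun _ h => ENNReal.pow_lt_top h.lt_top)]
  simp

end TreeMoments

/-! ### Generation counts as tree counts -/

/-- `birthTime` recurses through the parent at the head; the decomposition needs the split at the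
ancestor's child, the last entry. -/
theorem birthTime_append_singleton (x : List ℕ → ℕ → ℝ × ℝ) (u : List ℕ) (i : ℕ) :
    birthTime x (u ++ [i]) =
      perturbedWalk (x []) i + birthTime (fun w => x (w ++ [i])) u := by
  induction u with
  | nil => simp [birthTime]
  | cons k u ih =>
    rw [List.cons_append, birthTime, ih, birthTime]
    ring

theorem perturbedWalk_diag (x : ℕ → ℝ) (i : ℕ) :
    perturbedWalk (fun k => (x k, x k)) i = walk x (i + 1) := by
  rw [walk_succ]
  rfl

/-- Countable additivity of counting measure on the full σ-algebra. -/
theorem encard_iUnion_toENNReal {α : Type*} {s : ℕ → Set α}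
    (hs : Pairwise (Function.onFun Disjoint s)) :
    ((⋃ i, s i).encard : ENNReal) = ∑' i, ((s i).encard : ENNReal) := by
  let _ : MeasurableSpace α := ⊤
  have h := measure_iUnion (μ := Measure.count) hs fun _ => MeasurableSpace.measurableSet_top
  simpa only [Measure.count_apply MeasurableSpace.measurableSet_top] using h

theorem generationCount_diag (j : ℕ) (t : ℝ) (y : List ℕ → ℕ → ℝ) :
    (generationCount (fun v i => (y v i, y v i)) j t : ENNReal) = treeCount j t y := by
  induction j generalizing t y with
  | zero =>
    by_cases ht : 0 ≤ t
    · have : {v : List ℕ | v.length = 0 ∧ birthTime (fun v i => (y v i, y v i)) v ≤ t} = {[]} := by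
        ext v
        cases v <;> simp [birthTime, ht]
      rw [generationCount, this]
      simp [treeCount, ht]
    · have : {v : List ℕ | v.length = 0 ∧ birthTime (fun v i => (y v i, y v i)) v ≤ t} = ∅ := by
        ext v
        cases v <;> simp [birthTime, not_le.1 ht]
      rw [generationCount, this]
      simp [treeCount, ht]
  | succ j ih =>
    have hset : {v : List ℕ | v.length = j + 1 ∧ birthTime (fun v i => (y v i, y v i)) v ≤ t} =
        ⋃ i, (fun u => u ++ [i]) '' {u : List ℕ | u.length = j ∧
          birthTime (fun v k => (subtree i y v k, subtree i y v k)) u ≤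
            t - walk (y []) (i + 1)} := by
      ext v
      simp only [Set.mem_ofPred_eq, Set.mem_iUnion, Set.mem_image]
      constructor
      · rintro ⟨hl, hb⟩
        obtain ⟨u, i, rfl⟩ : ∃ u i, v = u ++ [i] :=
          ⟨_, _, (List.dropLast_append_getLast (List.ne_nil_of_length_eq_add_one hl)).symm⟩
        rw [birthTime_append_singleton, perturbedWalk_diag] at hb
        refine ⟨i, u, ⟨by simpa using hl, ?_⟩, rfl⟩
        have : birthTime (fun v k => (subtree i y v k, subtree i y v k)) u =
          birthTime (fun w k => (y (w ++ [i]) k, y (w ++ [i]) k)) u := rfl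
        linarith
      · rintro ⟨i, u, ⟨hl, hb⟩, rfl⟩
        refine ⟨by simpa using hl, ?_⟩
        rw [birthTime_append_singleton, perturbedWalk_diag]
        have : birthTime (fun v k => (subtree i y v k, subtree i y v k)) u =
          birthTime (fun w k => (y (w ++ [i]) k, y (w ++ [i]) k)) u := rfl
        linarith
    rw [generationCount, hset, encard_iUnion_toENNReal]
    · rw [treeCount]
      refine tsum_congr fun i => ?_
      rw [← ih, generationCount, Function.Injective.encard_image]
      exact fun _ _ h => List.append_cancel_right h
    · intro i k hik
      rw [Function.onFun, Set.disjoint_left]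
      rintro _ ⟨u, _, rfl⟩ ⟨w, _, h⟩
      exact hik (by simpa using (List.append_inj' h rfl).2.symm)

/-- `toReal` and `toNat` both send infinity to zero, so no finiteness is needed. -/
theorem toReal_treeCount_eq (j : ℕ) (t : ℝ) (y : List ℕ → ℕ → ℝ) :
    (treeCount j t y).toReal = ((generationCount (fun v i => (y v i, y v i)) j t).toNat : ℝ) := by
  rw [← generationCount_diag]
  induction generationCount (fun v i => (y v i, y v i)) j t using ENat.recTopCoe <;> simp

/-! ### Transfer to the given probability space -/

section Transfer

variable {Ω₀ : Type*} [MeasurableSpace Ω₀] {P₀ : Measure Ω₀}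
  {Ω : Type*} [MeasurableSpace Ω] {P : Measure Ω}
  {ξ η : Ω₀ → ℝ} {X : List ℕ → ℕ → Ω → ℝ × ℝ}

theorem ae_pair_eq_diag (hX_ident : ∀ v i, IdentDistrib (X v i) (fun ω => (ξ ω, η ω)) P P₀)
    (hη : η =ᵐ[P₀] ξ) :
    ∀ᵐ ω ∂P, (fun v i => X v i ω) = fun v i => ((X v i ω).1, (X v i ω).1) := by
  have h : ∀ v i, ∀ᵐ ω ∂P, X v i ω = ((X v i ω).1, (X v i ω).1) := fun v i => by
    have hs : MeasurableSet {p : ℝ × ℝ | p.2 = p.1} :=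
      measurableSet_eq_fun measurable_snd measurable_fst
    filter_upwards [(hX_ident v i).symm.ae_snd (p := fun p => p.2 = p.1) hs hη] with ω hω
    exact Prod.ext rfl hω
  filter_upwards [ae_all_iff.2 fun v => ae_all_iff.2 (h v)] with ω hω
  exact funext fun v => funext fun i => hω v i

/-- Independence over pairs gives a product law on `List ℕ × ℕ → ℝ`, which currying carries to
`treeMeasure`. -/
theorem aemeasurable_and_map_fst_eq_treeMeasure
    (hX_ident : ∀ v i, IdentDistrib (X v i) (fun ω => (ξ ω, η ω)) P P₀)
    (hX_indep : iIndepFun (fun p : List ℕ × ℕ => X p.1 p.2) P)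
    (ν : Measure ℝ) [IsProbabilityMeasure ν] (hν : P₀.map ξ = ν) :
    AEMeasurable (fun ω v i => (X v i ω).1) P ∧
      P.map (fun ω v i => (X v i ω).1) = treeMeasure ν := by
  have hm : ∀ p : List ℕ × ℕ, AEMeasurable (fun ω => (X p.1 p.2 ω).1) P := fun p =>
    measurable_fst.comp_aemeasurable (hX_ident p.1 p.2).aemeasurable_fst
  have hi : iIndepFun (fun (p : List ℕ × ℕ) ω => (X p.1 p.2 ω).1) P :=
    hX_indep.comp (fun _ => Prod.fst) fun _ => measurable_fst
  have hlaw : ∀ p : List ℕ × ℕ, P.map (fun ω => (X p.1 p.2 ω).1) = ν := fun p =>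
    ((hX_ident p.1 p.2).comp measurable_fst).map_eq.trans hν
  have h1 := hi.map_fun_eq_infinitePi_map₀' hm
  simp_rw [hlaw] at h1
  have hcurry : Measurable (MeasurableEquiv.curry (List ℕ) ℕ ℝ) := MeasurableEquiv.measurable _
  have h2 := Measure.infinitePi_map_curry (ι := List ℕ) (κ := ℕ) (X := ℝ) fun _ _ => ν
  have hm' : AEMeasurable (fun ω (p : List ℕ × ℕ) => (X p.1 p.2 ω).1) P := aemeasurable_pi_iff.2 hm
  refine ⟨hcurry.comp_aemeasurable hm', ?_⟩
  refine Eq.trans ?_ h2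
  rw [← h1, AEMeasurable.map_map_of_aemeasurable hcurry.aemeasurable hm']
  rfl

end Transfer

theorem mainTheorem3
    {Ω₀ : Type*} [MeasurableSpace Ω₀] (P₀ : Measure Ω₀) [IsProbabilityMeasure P₀]
    {Ω : Type*} [MeasurableSpace Ω] (P : Measure Ω) [IsProbabilityMeasure P]
    -- the generic pair `(ξ, η)`
    (ξ η : Ω₀ → ℝ)
    -- the pairs driving the reproduction: `X v i` is the pair number `i` of the individual `v`
    (X : List ℕ → ℕ → Ω → ℝ × ℝ)
    (hX_ident : ∀ v i, IdentDistrib (X v i) (fun ω => (ξ ω, η ω)) P P₀)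
    (hX_indep : iIndepFun (fun p : List ℕ × ℕ => X p.1 p.2) P)
    (hξ_pos : ∀ᵐ ω ∂P₀, 0 < ξ ω)
    (hη : η =ᵐ[P₀] ξ)
    (hξ_nonlattice : IsNonlattice (P₀.map ξ))
    (hξ_sq : MemLp ξ 2 P₀)
    (hξ_var : 0 < Var[ξ; P₀])
    (j : ℕ) (hj : 1 ≤ j) :
    (∀ᵐ ω ∂P, ∀ t : ℝ, generationCount (fun v i => X v i ω) j t ≠ ⊤) ∧
    (∀ t : ℝ, MemLp (fun ω => ((generationCount (fun v i => X v i ω) j t).toNat : ℝ)) 2 P) ∧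
    Tendsto
      (fun t : ℝ =>
        Var[fun ω => ((generationCount (fun v i => X v i ω) j t).toNat : ℝ); P]
          / t ^ (2 * j - 1))
      atTop
      (𝓝 (Var[ξ; P₀] /
        ((2 * (j : ℝ) - 1) * ((j - 1).factorial : ℝ) ^ 2 * (∫ ω, ξ ω ∂P₀) ^ (2 * j + 1)))) := by
  have hξm : AEMeasurable ξ P₀ := hξ_sq.1.aemeasurable
  obtain ⟨ν, hνeq⟩ : ∃ ν, P₀.map ξ = ν := ⟨_, rfl⟩
  have hνp : IsProbabilityMeasure ν := hνeq ▸ Measure.isProbabilityMeasure_map hξm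
  have hν : IsStepLaw ν := by
    subst hνeq
    exact ⟨(ae_map_iff hξm measurableSet_Ioi).2 hξ_pos,
      (memLp_map_measure_iff measurable_id.aestronglyMeasurable hξm).2 hξ_sq⟩
  have hmean : ∫ y, y ∂ν = ∫ ω, ξ ω ∂P₀ := by
    rw [← hνeq]
    exact integral_map (f := fun y => y) hξm measurable_id.aestronglyMeasurable
  have hvar : Var[id; ν] = Var[ξ; P₀] := by
    rw [← hνeq, variance_map measurable_id.aemeasurable hξm]
    rfl
  obtain ⟨hΦ, hmap⟩ := aemeasurable_and_map_fst_eq_treeMeasure hX_ident hX_indep ν hνeq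
  have hdiag := ae_pair_eq_diag hX_ident hη
  have hcount : ∀ t : ℝ,
      (fun ω => ((generationCount (fun v i => X v i ω) j t).toNat : ℝ)) =ᵐ[P]
        (fun y => (treeCount j t y).toReal) ∘ fun ω v i => (X v i ω).1 := fun t => by
    filter_upwards [hdiag] with ω hω
    rw [hω, Function.comp_apply, toReal_treeCount_eq]
  have hmeas : ∀ t : ℝ, Measurable fun y => (treeCount j t y).toReal :=
    fun t => (measurable_treeCount j t).ennreal_toReal
  refine ⟨?_, fun t => ?_, ?_⟩
  -- Monotonicity in `t` reduces all times to the countably many integer ones, giving one null set.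
  · have hfin : ∀ n : ℕ, ∀ᵐ ω ∂P, treeCount j n (fun v i => (X v i ω).1) ≠ ⊤ := fun n => by
      refine ae_of_ae_map (p := fun y => treeCount j n y ≠ ⊤) hΦ ?_
      rw [hmap]
      exact ae_treeCount_ne_top hν j n
    filter_upwards [hdiag, ae_all_iff.2 hfin] with ω hω hfin t htop
    obtain ⟨n, hn⟩ := exists_nat_ge t
    refine hfin n (top_le_iff.1 ?_)
    rw [hω] at htop
    calc ⊤ = treeCount j t fun v i => (X v i ω).1 := by
          rw [← generationCount_diag, htop, ENat.toENNReal_top]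
      _ ≤ _ := treeCount_mono j _ hn
  · rw [memLp_congr_ae (hcount t), ← memLp_map_measure_iff (hmeas t).aestronglyMeasurable hΦ, hmap]
    exact memLp_toReal_treeCount hν j t
  -- With `j = k + 1` the truncated subtractions disappear, and `m ^ (2 * k) * m ^ 3` is the
  -- required power of the mean.
  · obtain ⟨k, rfl⟩ : ∃ k, j = k + 1 := ⟨j - 1, by omega⟩
    have h := tendsto_treeVariance_succ hν (tendsto_treeSecondMoment hν k)
    have hV : ∀ t : ℝ,
        Var[fun ω => ((generationCount (fun v i => X v i ω) (k + 1) t).toNat : ℝ); P] =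
          treeVariance ν (k + 1) t := fun t => by
      rw [variance_congr (hcount t), ← variance_map (hmeas t).aemeasurable hΦ, hmap,
        variance_toReal_treeCount hν]
    simp_rw [hV]
    rw [hvar, hmean] at h
    have hm0 : 0 < ∫ ω, ξ ω ∂P₀ := hmean ▸ hν.integral_pos
    have he : 2 * (k + 1) - 1 = 2 * k + 1 := by omega
    rw [he]
    convert h using 2
    have hk : ((2 : ℝ) * ((k + 1 : ℕ) : ℝ) - 1) = 2 * k + 1 := by push_cast; ring
    rw [hk, Nat.add_sub_cancel]
    field_simp
    ring
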